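/- **Theorem 3.1.** Let $p\ge 2$, fix a unit vector $\theta_1^0\in\mathbb R^p$, a real number $v>0$ and a bounded sequence $(r_n)$ of positive real numbers. For every $n$, let ${\rm P}_{\theta_1^0,r_n,v}$ be the hypothesis under which $X_{n1},\dots,X_{nn}$ are independent and $p$-variate normal with mean $0$ and covariance matrix $\Sigma_n=I_p+r_n v\,\theta_1^0\theta_1^{0\prime}$. Let $\bar X_n=\frac1n\sum_{i=1}^n X_{ni}$, let $S_n=\frac1n\sum_{i=1}^n (X_{ni}-\bar X_n)(X_{ni}-\bar X_n)'$ be the sample covariance matrix, let $\hat\lambda_{n1}\ge\dots\ge\hat\lambda_{np}$ be its eigenvalues, and let $\hat\theta_{nj}$ be a unit eigenvector of $S_n$ associated with $\hat\lambda_{nj}$, $j=1,\dots,p$ (an arbitrary choice, measurable in the sample). Let $\tilde\theta_{n2},\dots,\tilde\theta_{np}$ result from the Gram–Schmidt orthonormalization of $\theta_1^0,\hat\theta_{n2},\dots,\hat\theta_{np}$, that is, $$\tilde\theta_{nj}=\frac{\big(I_p-\theta_1^0\theta_1^{0\prime}-\sum_{k=2}^{j-1}\tilde\theta_{nk}\tilde\theta_{nk}'\big)\hat\theta_{nj}}{\big\|\big(I_p-\theta_1^0\theta_1^{0\prime}-\sum_{k=2}^{j-1}\tilde\theta_{nk}\tilde\theta_{nk}'\big)\hat\theta_{nj}\big\|},\qquad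 j=2,\dots,p,$$ and put $$Q_{\rm HPV}^{(n)}=\frac{n}{\hat\lambda_{n1}}\sum_{j=2}^p\hat\lambda_{nj}^{-1}\big(\tilde\theta_{nj}'S_n\theta_1^0\big)^2 .$$ (For $n>p$ this is well defined and does not depend on the choice of the $\hat\theta_{nj}$, with probability one.) Then, under ${\rm P}_{\theta_1^0,r_n,v}$, as $n\to\infty$, $$Q_{\rm HPV}^{(n)}\stackrel{\mathcal D}{\to}\chi^2_{p-1}.$$ Consequently, for every $\alpha\in(0,1)$, the test $\phi_{\rm HPV}$ that rejects when $Q_{\rm HPV}^{(n)}>\chi^2_{p-1,1-\alpha}$, the quantile of order $1-\alpha$ of the chi-square distribution with $p-1$ degrees of freedom, has asymptotic size $\alpha$ under this sequence of null hypotheses: $\lim_{n\to\infty}{\rm P}_{\theta_1^0,r_n,v}\big[Q_{\rm HPV}^{(n)}>\chi^2_{p-1,1-\alpha}\big]=\alpha$. This holds for every bounded positive sequence $(r_n)$, in particular in each of the regimes (i) $r_n\equiv1$; (ii) $r_n\to0$ with $\sqrt n\,r_n\to\infty$; (iii) $r_n=1/\sqrt n$; (iv) $r_n=o(1/\sqrt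 n)$. -/

import Mathlib

open MeasureTheory ProbabilityTheory Filter Topology

noncomputable section

namespace SpikedPCA

/-- The single-spiked covariance matrix `σ² (I_p + r v θ θ')`. -/
def spikedCov {p : ℕ} (σ : ℝ) (θ : EuclideanSpace ℝ (Fin p)) (r v : ℝ) :
    Matrix (Fin p) (Fin p) ℝ :=
  σ ^ 2 • (1 + (r * v) • Matrix.vecMulVec θ.ofLp θ.ofLp)

/-- The hypothesis `P_{μ, σ, θ, r, v}`: the law of a random sample of size `n` from the `p`-variate
normal distribution with mean `μ` and covariance matrix `σ² (I_p + r v θ θ')`. -/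
def spikedLaw {p : ℕ} (n : ℕ) (μ : EuclideanSpace ℝ (Fin p)) (σ : ℝ)
    (θ : EuclideanSpace ℝ (Fin p)) (r v : ℝ) : Measure (Fin n → EuclideanSpace ℝ (Fin p)) :=
  Measure.pi fun _ => multivariateGaussian μ (spikedCov σ θ r v)

instance {p n : ℕ} (μ : EuclideanSpace ℝ (Fin p)) (σ : ℝ)
    (θ : EuclideanSpace ℝ (Fin p)) (r v : ℝ) : IsProbabilityMeasure (spikedLaw n μ σ θ r v) := by
  unfold spikedLaw; infer_instance

/-- The sample average. -/
def sampleMean {p n : ℕ} (x : Fin n → EuclideanSpace ℝ (Fin p)) : EuclideanSpace ℝ (Fin p) :=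
  (n : ℝ)⁻¹ • ∑ i, x i

/-- The sample covariance matrix `S = n⁻¹ ∑ (x i - x̄) (x i - x̄)'`. -/
def sampleCov {p n : ℕ} (x : Fin n → EuclideanSpace ℝ (Fin p)) : Matrix (Fin p) (Fin p) ℝ :=
  (n : ℝ)⁻¹ • ∑ i, Matrix.vecMulVec (x i - sampleMean x).ofLp (x i - sampleMean x).ofLp

theorem sampleCov_isHermitian {p n : ℕ} (x : Fin n → EuclideanSpace ℝ (Fin p)) :
    (sampleCov x).IsHermitian := by
  ext a b
  simp [sampleCov, Matrix.sum_apply, Matrix.vecMulVec_apply, mul_comm]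

/-- The eigenvalues of the sample covariance matrix, with multiplicity and in decreasing order;
the index `j : Fin p` stands for the `(j+1)`-th largest one. -/
def sampleEigenvalue {p n : ℕ} (x : Fin n → EuclideanSpace ℝ (Fin p)) (j : Fin p) : ℝ :=
  (sampleCov_isHermitian x).eigenvalues₀ (Fin.cast (Fintype.card_fin p).symm j)

/-- `θhat` is a (measurable) choice of sample eigenvectors: `θhat x j` is a unit eigenvector of the
sample covariance matrix of `x` for the `(j+1)`-th largest eigenvalue. The choice, such as that of
signs, is otherwise arbitrary. -/
structure IsSampleEigenvectors {p n : ℕ}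
    (θhat : (Fin n → EuclideanSpace ℝ (Fin p)) → Fin p → EuclideanSpace ℝ (Fin p)) : Prop where
  measurable : ∀ j, Measurable fun x => θhat x j
  norm_eq_one : ∀ x j, ‖θhat x j‖ = 1
  mulVec_eq : ∀ x j,
    Matrix.mulVec (sampleCov x) (θhat x j).ofLp = sampleEigenvalue x j • (θhat x j).ofLp

/-- The Gram-Schmidt orthonormalization of `θ₀, u 1, …, u (p - 1)`, in this order
(the vector `u 0` is replaced by `θ₀`). -/
def gramSchmidtFrom {p : ℕ} [NeZero p] (θ₀ : EuclideanSpace ℝ (Fin p))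
    (u : Fin p → EuclideanSpace ℝ (Fin p)) : Fin p → EuclideanSpace ℝ (Fin p) :=
  InnerProductSpace.gramSchmidtNormed ℝ (Function.update u 0 θ₀)

/-- The statistic
`Q = (n / lam₁) ∑_{j ≥ 2} lam_j⁻¹ (θtilde_j' S θ₀)²`,
where `lam₁ ≥ … ≥ lam_p` are the sample eigenvalues and `θtilde_j` results from the Gram-Schmidt
orthonormalization of `θ₀, θhat_2, …, θhat_p`. -/
def hpvStatistic {p n : ℕ} [NeZero p] (θ₀ : EuclideanSpace ℝ (Fin p))
    (θhat : (Fin n → EuclideanSpace ℝ (Fin p)) → Fin p → EuclideanSpace ℝ (Fin p))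
    (x : Fin n → EuclideanSpace ℝ (Fin p)) : ℝ :=
  (n : ℝ) / sampleEigenvalue x 0 * ∑ j ∈ Finset.univ.erase (0 : Fin p),
    (sampleEigenvalue x j)⁻¹ *
      (dotProduct (gramSchmidtFrom θ₀ (θhat x) j).ofLp
        (Matrix.mulVec (sampleCov x) θ₀.ofLp)) ^ 2

/-- The chi-square distribution with `k` degrees of freedom: the law of the sum of the squares of
`k` independent standard normal random variables. -/
def chiSquare (k : ℕ) : Measure ℝ :=
  (Measure.pi fun _ : Fin k => gaussianReal 0 1).map fun z => ∑ i, z i ^ 2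

instance (k : ℕ) : IsProbabilityMeasure (chiSquare k) :=
  Measure.isProbabilityMeasure_map (Measurable.aemeasurable (by fun_prop))

/-- The quantile of order `β` of the chi-square distribution with `k` degrees of freedom. -/
def chiSquareQuantile (k : ℕ) (β : ℝ) : ℝ :=
  sInf {x : ℝ | β ≤ cdf (chiSquare k) x}

/-- The test `φ` of nominal level `α`, as a `{0, 1}`-valued function of the sample: it rejects
(takes the value one) when the statistic exceeds the upper `α`-quantile of the chi-square
distribution with `p - 1` degrees of freedom. -/
def hpvTest {p n : ℕ} [NeZero p] (α : ℝ) (θ₀ : EuclideanSpace ℝ (Fin p))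
    (θhat : (Fin n → EuclideanSpace ℝ (Fin p)) → Fin p → EuclideanSpace ℝ (Fin p)) :
    (Fin n → EuclideanSpace ℝ (Fin p)) → ℝ :=
  Set.indicator {x | chiSquareQuantile (p - 1) (1 - α) < hpvStatistic θ₀ θhat x} 1

end SpikedPCA

end

namespace SpikedPCA

/-! All sample sizes are realised on one infinite array of independent standard normal variables.
Complete `θ₀` to an orthonormal basis `b` with `b 0 = θ₀`; multiplying column `0` of the array by
`√(1 + r n * v)` and using the columns as coordinates in `b` gives a sample with the required law
(`map_arraySample`). The array does not involve `r n`, so the strong law makes its empirical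
covariance matrix tend to the identity almost surely, whatever the regime. As `r` is bounded, the
sample eigenvalues minus `1 + r n * v, 1, …, 1` tend to zero (`tendsto_sampleEigenvalue_sub`); no
consistency of the eigenvectors is needed.

Indeed the eigenvectors drop out. If no eigenvector of `S` is orthogonal to `θ₀`, which holds almost
surely for `p < n` (`ae_det_krylov_ne_zero`), then the Gram-Schmidt family is an orthonormal basis
starting with `θ₀`, and the unweighted sum of squares is the squared norm of the part of `S θ₀`
orthogonal to `θ₀`, whatever the basis (`sum_sq_gramSchmidtFrom`).

Suitably scaled, this norm is the sum of squares of the projections of columns `j ≠ 0` on the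
direction of the centred column `0`. Given column `0`, these are independent standard normal
variables, so `projectionStatistic` is exactly chi-square for every `n ≠ 0`. The eigenvalue weights
only cause a relative error tending to zero almost surely, which Slutsky's lemma absorbs. The size
follows because the limit law has no atoms. -/

/-! ### Zero sets of polynomials -/

/-- The zero set of a nonzero polynomial is null for a product of atomless probability measures,
version for variables indexed by `Fin n`. -/
lemma measure_pi_fin_zeros_eq_zero (ν : Measure ℝ) [IsProbabilityMeasure ν]
    [NullSingletonClass ν] {n : ℕ} (f : MvPolynomial (Fin n) ℝ) (hf : f ≠ 0) :
    Measure.pi (fun _ : Fin n => ν) {x | MvPolynomial.eval x f = 0} = 0 := by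
  induction n with
  | zero =>
    convert measure_empty (μ := Measure.pi fun _ : Fin 0 => ν)
    ext x
    simp only [Set.mem_ofPred_eq, Set.mem_empty_iff_false, iff_false]
    intro h
    apply hf
    apply MvPolynomial.funext
    intro y
    rw [Subsingleton.elim y x, h, map_zero]
  | succ n ih =>
    have hmeas : MeasurableSet {x : Fin (n + 1) → ℝ | MvPolynomial.eval x f = 0} :=
      (isClosed_eq (MvPolynomial.continuous_eval f) continuous_const).measurableSet
    have hmp := (measurePreserving_piFinSuccAbove (fun _ : Fin (n + 1) => ν) 0).symm
    have hg : MvPolynomial.finSuccEquiv ℝ n f ≠ 0 := by simpa using hf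
    set g := MvPolynomial.finSuccEquiv ℝ n f with hgdef
    -- View `f` as a polynomial in the first variable. Off the null set where its leading
    -- coefficient vanishes, each fibre is a finite set of roots; conclude by Fubini.
    have hlead := ih g.leadingCoeff (Polynomial.leadingCoeff_ne_zero.2 hg)
    rw [← hmp.measure_preimage hmeas.nullMeasurableSet,
      Measure.prod_apply_symm (hmp.measurable hmeas),
      lintegral_eq_zero_iff (measurable_measure_prodMk_right (hmp.measurable hmeas))]
    have hae : ∀ᵐ y ∂(Measure.pi fun _ : Fin n => ν),
        MvPolynomial.eval y g.leadingCoeff ≠ 0 := by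
      rw [ae_iff]; simpa using hlead
    filter_upwards [hae] with y hy
    have hne : Polynomial.map (MvPolynomial.eval y) g ≠ 0 := by
      intro h0
      apply hy
      have := congrArg (fun q => Polynomial.coeff q g.natDegree) h0
      simpa [Polynomial.coeff_map] using this
    refine measure_mono_null (t := {t | (Polynomial.map (MvPolynomial.eval y) g).IsRoot t}) ?_ ?_
    · intro t ht
      simp only [Set.mem_preimage, Set.mem_ofPred_eq] at ht
      rw [Set.mem_ofPred_eq, Polynomial.IsRoot, hgdef, ← MvPolynomial.eval_eq_eval_mv_eval', ← ht]
      congr 2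
      exact (Fin.insertNth_zero' t y).symm
    · exact (Polynomial.finite_setOfPred_isRoot hne).measure_zero _

/-- The zero set of a nonzero polynomial is null for a product of atomless probability measures. -/
lemma measure_pi_zeros_eq_zero {σ : Type*} [Fintype σ] (ν : Measure ℝ) [IsProbabilityMeasure ν]
    [NullSingletonClass ν] (f : MvPolynomial σ ℝ) (hf : f ≠ 0) :
    Measure.pi (fun _ : σ => ν) {x | MvPolynomial.eval x f = 0} = 0 := by
  let e := Fintype.equivFin σ
  have hmeas : MeasurableSet {x : σ → ℝ | MvPolynomial.eval x f = 0} :=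
    (isClosed_eq (MvPolynomial.continuous_eval f) continuous_const).measurableSet
  have hmp := measurePreserving_piCongrLeft (fun _ : σ => ν) e.symm
  rw [← hmp.measure_preimage hmeas.nullMeasurableSet]
  have h := measure_pi_fin_zeros_eq_zero ν (MvPolynomial.rename e f)
    (by rw [Ne, map_eq_zero_iff _ (MvPolynomial.rename_injective _ e.injective)]; exact hf)
  convert h using 2
  ext x
  simp only [Set.mem_preimage, Set.mem_ofPred_eq, MvPolynomial.eval_rename]
  have : (MeasurableEquiv.piCongrLeft (fun _ : σ => ℝ) e.symm) x = x ∘ e := by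
    ext i
    have := MeasurableEquiv.piCongrLeft_apply_apply (β := fun _ : σ => ℝ) e.symm x (e i)
    simpa using this
  rw [this]

/-! ### The chi-square law and its quantiles -/

instance : NullSingletonClass (gaussianReal 0 1) := nullSingletonClass_gaussianReal one_ne_zero

lemma nullSingletonClass_chiSquare {k : ℕ} (hk : 0 < k) : NullSingletonClass (chiSquare k) where
  measure_singleton c := by
    rw [chiSquare, Measure.map_apply (by fun_prop) (measurableSet_singleton c)]
    let f : MvPolynomial (Fin k) ℝ := ∑ i, MvPolynomial.X i ^ 2 - MvPolynomial.C c
    -- The values at `0` and at `1` are `-c` and `k - c`, which differ.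
    have hf : f ≠ 0 := by
      intro h
      have h1 := congrArg (MvPolynomial.eval (0 : Fin k → ℝ)) h
      have h2 := congrArg (MvPolynomial.eval (1 : Fin k → ℝ)) h
      simp [f] at h1 h2
      simp [h1] at h2
      omega
    convert measure_pi_zeros_eq_zero (gaussianReal 0 1) f hf using 2
    ext x
    simp [f, sub_eq_zero]

/-- A distribution function without jumps takes the value `β ∈ (0, 1)` at the quantile of
order `β`. -/
lemma cdf_chiSquareQuantile {k : ℕ} (hk : 0 < k) {β : ℝ} (h0 : 0 < β) (h1 : β < 1) :
    cdf (chiSquare k) (chiSquareQuantile k β) = β := by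
  have := nullSingletonClass_chiSquare hk
  set F := cdf (chiSquare k)
  have hbdd : BddBelow {x : ℝ | β ≤ F x} := by
    obtain ⟨a, ha⟩ := ((tendsto_cdf_atBot (chiSquare k)).eventually_lt_const h0).exists
    refine ⟨a, fun x hx => ?_⟩
    by_contra hlt
    exact absurd (hx.trans ((monotone_cdf (chiSquare k)) (not_le.1 hlt).le)) (not_le.2 ha)
  have hne : {x : ℝ | β ≤ F x}.Nonempty := by
    obtain ⟨a, ha⟩ := ((tendsto_cdf_atTop (chiSquare k)).eventually_const_lt h1).exists
    exact ⟨a, ha.le⟩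
  have hcont : Continuous F := by
    rw [continuous_iff_continuousAt]
    intro x
    rw [(monotone_cdf (chiSquare k)).continuousAt_iff_leftLim_eq_rightLim,
      StieltjesFunction.rightLim_eq]
    have h := StieltjesFunction.measure_singleton F x
    rw [measure_cdf, measure_singleton] at h
    have h2 := ENNReal.ofReal_eq_zero.1 h.symm
    exact le_antisymm ((monotone_cdf _).leftLim_le le_rfl) (by linarith)
  refine le_antisymm ?_ ?_
  · by_contra hlt
    rw [not_le] at hlt
    have : ∀ᶠ x in 𝓝[<] (chiSquareQuantile k β), β < F x :=
      (hcont.tendsto _).mono_left nhdsWithin_le_nhds |>.eventually_const_lt hlt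
    obtain ⟨x, hx, hxlt⟩ := (this.and self_mem_nhdsWithin).exists
    exact absurd (csInf_le hbdd hx.le) (not_le.2 hxlt)
  · exact (isClosed_le continuous_const hcont).csInf_mem hne hbdd

/-- The size of the test whose statistic converges to the chi-square distribution. -/
lemma tendsto_measureReal_gt_quantile {k : ℕ} (hk : 0 < k) {Ω : ℕ → Type*}
    [∀ n, MeasurableSpace (Ω n)] {μ : ∀ n, Measure (Ω n)} [∀ n, IsProbabilityMeasure (μ n)]
    {Q : ∀ n, Ω n → ℝ} (hQ : TendstoInDistribution Q atTop id μ (chiSquare k))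
    {α : ℝ} (h0 : 0 < α) (h1 : α < 1) :
    Tendsto (fun n => (μ n).real {x | chiSquareQuantile k (1 - α) < Q n x}) atTop (𝓝 α) := by
  have := nullSingletonClass_chiSquare hk
  set q := chiSquareQuantile k (1 - α)
  have h := ProbabilityMeasure.tendsto_measure_of_null_frontier_of_tendsto' hQ.tendsto
    (E := Set.Ioi q) (by simp)
  have hlim : (chiSquare k) (Set.Ioi q) = ENNReal.ofReal α := by
    rw [← Set.compl_Iic, prob_compl_eq_one_sub measurableSet_Iic, ← ofReal_cdf,
      cdf_chiSquareQuantile hk (by linarith) (by linarith), ← ENNReal.ofReal_one,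
      ← ENNReal.ofReal_sub _ (by linarith)]
    simp
  simp only [ProbabilityMeasure.coe_mk, Measure.map_id, hlim] at h
  have h' := (ENNReal.tendsto_toReal ENNReal.ofReal_ne_top).comp h
  rw [ENNReal.toReal_ofReal h0.le] at h'
  refine h'.congr fun n => ?_
  rw [Function.comp_apply, Measure.map_apply_of_aemeasurable (hQ.forall_aemeasurable n)
    measurableSet_Ioi]
  rfl

/-! ### Gaussian projections on a random direction -/

/-- A unit linear combination of independent standard normal variables is standard normal. -/
lemma map_sum_mul_pi_gaussianReal {ι : Type*} [Fintype ι] (u : ι → ℝ) (hu : ∑ i, u i ^ 2 = 1) :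
    (Measure.pi fun _ : ι => gaussianReal 0 1).map (fun w => ∑ i, u i * w i) =
      gaussianReal 0 1 := by
  let L : StrongDual ℝ (EuclideanSpace ℝ ι) := innerSL ℝ (WithLp.toLp 2 u)
  have hL : ‖L‖ = 1 := by
    rw [innerSL_apply_norm, EuclideanSpace.norm_eq]
    simp [hu]
  have h : (fun w : ι → ℝ => ∑ i, u i * w i) = L ∘ (WithLp.toLp 2) := by
    ext w
    simp [L, PiLp.inner_apply, mul_comm]
  rw [h, ← Measure.map_map (by fun_prop) (by fun_prop), map_pi_eq_stdGaussian,
    IsGaussian.map_eq_gaussianReal, integral_strongDual_stdGaussian, variance_dual_stdGaussian,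
    hL]
  simp

/-- If all sections of `h` have law `ρ` then so has `h`. -/
lemma map_prod_eq_of_forall_map_eq {α β γ : Type*} [MeasurableSpace α] [MeasurableSpace β]
    [MeasurableSpace γ] (μ : Measure α) [IsProbabilityMeasure μ] (ν : Measure β)
    [IsProbabilityMeasure ν] (ρ : Measure γ) {h : α × β → γ} (hh : Measurable h)
    (H : ∀ a, ν.map (fun b => h (a, b)) = ρ) : (μ.prod ν).map h = ρ := by
  ext s hs
  rw [Measure.map_apply hh hs, Measure.prod_apply (hh hs)]
  have : ∀ a, ν (Prod.mk a ⁻¹' (h ⁻¹' s)) = ρ s := by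
    intro a
    rw [← H a, Measure.map_apply (by fun_prop) hs]
    rfl
  simp [this]

lemma map_sum_sq_pi_gaussianReal {ι : Type*} [Fintype ι] :
    (Measure.pi fun _ : ι => gaussianReal 0 1).map (fun z => ∑ i, z i ^ 2) =
      chiSquare (Fintype.card ι) := by
  have hmp := measurePreserving_piCongrLeft (fun _ : ι => gaussianReal 0 1)
    (Fintype.equivFin ι).symm
  rw [← hmp.map_eq, Measure.map_map (by fun_prop) (by fun_prop), chiSquare]
  congr 1
  ext z
  rw [Function.comp_apply, ← (Fintype.equivFin ι).symm.sum_comp]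
  refine Finset.sum_congr rfl fun i _ => ?_
  rw [MeasurableEquiv.piCongrLeft_apply_apply]

/-- Rows of independent standard normal variables projected on a random direction that depends on
the row `k` only: the sum of the squares of the projections of the other rows is chi-square. -/
lemma map_sum_sq_projection {ι κ : Type*} [Fintype ι] [Fintype κ] [DecidableEq κ] (k : κ)
    (u : (ι → ℝ) → ι → ℝ) (hu : ∀ i, Measurable fun x => u x i) (hu1 : ∀ x, ∑ i, u x i ^ 2 = 1) :
    (Measure.pi fun _ : κ => Measure.pi fun _ : ι => gaussianReal 0 1).map
      (fun y => ∑ j ∈ Finset.univ.erase k, (∑ i, u (y k) i * y j i) ^ 2) =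
      chiSquare (Fintype.card κ - 1) := by
  let G : Measure (ι → ℝ) := Measure.pi fun _ : ι => gaussianReal 0 1
  have hmp := measurePreserving_piEquivPiSubtypeProd (fun _ : κ => G) (fun j => j = k)
  let h : (({j // j = k} → ι → ℝ) × ({j // ¬ j = k} → ι → ℝ)) → ℝ :=
    fun a => ∑ j, (∑ i, u (a.1 ⟨k, rfl⟩) i * a.2 j i) ^ 2
  have hmeas : Measurable h := by
    have : ∀ i, Measurable fun a : (({j // j = k} → ι → ℝ) × ({j // ¬ j = k} → ι → ℝ)) =>
      u (a.1 ⟨k, rfl⟩) i := fun i => (hu i).comp (by fun_prop)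
    fun_prop
  have hcomp : (fun y : κ → ι → ℝ =>
      ∑ j ∈ Finset.univ.erase k, (∑ i, u (y k) i * y j i) ^ 2) =
      h ∘ (MeasurableEquiv.piEquivPiSubtypeProd (fun _ : κ => ι → ℝ) (fun j => j = k)) := by
    ext y
    rw [Function.comp_apply]
    exact Finset.sum_subtype _ (by simp) _
  rw [hcomp, ← Measure.map_map hmeas (by fun_prop)]
  erw [hmp.map_eq]
  -- With row `k` frozen, the direction is a fixed unit vector and the law of the sum no longer
  -- depends on it.
  refine map_prod_eq_of_forall_map_eq _ _ _ hmeas fun a => ?_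
  have hc : Fintype.card {j // ¬ j = k} = Fintype.card κ - 1 := by
    rw [Fintype.card_subtype_compl]; simp
  rw [← hc, ← map_sum_sq_pi_gaussianReal]
  have hpi := Measure.pi_map_pi (μ := fun _ : {j // ¬ j = k} => G)
    (f := fun _ w => ∑ i, u (a ⟨k, rfl⟩) i * w i)
    (hμ := fun _ => by rw [map_sum_mul_pi_gaussianReal _ (hu1 _)]; infer_instance)
    (fun _ => (Finset.measurable_sum _ fun i _ =>
      (measurable_pi_apply i).const_mul _).aemeasurable)
  simp only [G, map_sum_mul_pi_gaussianReal _ (hu1 _)] at hpi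
  rw [← hpi, Measure.map_map (by fun_prop) (by fun_prop)]
  rfl

/-! ### Coupling all samples through one Gaussian array -/

/-- The law of an array of independent standard normal variables with `p` columns and infinitely
many rows. -/
noncomputable def arrayLaw (p : ℕ) : Measure (ℕ × Fin p → ℝ) :=
  Measure.infinitePi fun _ => gaussianReal 0 1

instance (p : ℕ) : IsProbabilityMeasure (arrayLaw p) := by unfold arrayLaw; infer_instance

lemma map_arrayLaw_of_injective {p : ℕ} {ι : Type*} [Fintype ι] {f : ι → ℕ × Fin p}
    (hf : Function.Injective f) :
    (arrayLaw p).map (fun ω i => ω (f i)) = Measure.pi fun _ => gaussianReal 0 1 := by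
  rw [arrayLaw, Measure.map_infinitePi_infinitePi_of_inj hf, Measure.infinitePi_eq_pi]

lemma map_arrayLaw_of_injective₂ {p : ℕ} {ι κ : Type*} [Fintype ι] [Fintype κ]
    {f : ι × κ → ℕ × Fin p} (hf : Function.Injective f) :
    (arrayLaw p).map (fun ω i j => ω (f (i, j))) =
      Measure.pi fun _ => Measure.pi fun _ => gaussianReal 0 1 := by
  have h := Measure.infinitePi_map_curry (fun (_ : ι) (_ : κ) => gaussianReal 0 1)
  simp only [Measure.infinitePi_eq_pi] at h
  rw [← h, ← map_arrayLaw_of_injective hf, Measure.map_map (by fun_prop) (by fun_prop)]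
  rfl

/-- The standard deviations of the spiked normal distribution along an orthonormal basis whose first
vector is the spike. -/
noncomputable def spikeScale {p : ℕ} [NeZero p] (t : ℝ) (j : Fin p) : ℝ :=
  if j = 0 then √(1 + t) else 1

/-- A sample of size `n` built from an array of standard normal variables. -/
noncomputable def arraySample {p : ℕ} [NeZero p]
    (b : OrthonormalBasis (Fin p) ℝ (EuclideanSpace ℝ (Fin p))) (t : ℝ) (n : ℕ)
    (ω : ℕ × Fin p → ℝ) : Fin n → EuclideanSpace ℝ (Fin p) :=
  fun i => ∑ j, (spikeScale t j * ω (i, j)) • b j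

-- With `P = θθ'` idempotent, `(1 + aP)² = 1 + (a² + 2a)P`, and `a = √(1 + r * v) - 1` solves `a² +
-- 2a = r * v`. Since `a ≥ 0`, this root is the positive one.
open scoped MatrixOrder Matrix.Norms.L2Operator in
lemma sqrt_spikedCov {p : ℕ} (θ : EuclideanSpace ℝ (Fin p)) (hθ : ‖θ‖ = 1) (r v : ℝ)
    (h : 0 ≤ r * v) :
    CFC.sqrt (spikedCov 1 θ r v) =
      1 + (√(1 + r * v) - 1) • Matrix.vecMulVec θ.ofLp θ.ofLp := by
  have hdot : θ.ofLp ⬝ᵥ θ.ofLp = 1 := by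
    have := real_inner_self_eq_norm_sq θ
    rw [hθ, one_pow, PiLp.inner_apply] at this
    exact this
  have hproj : Matrix.vecMulVec θ.ofLp θ.ofLp * Matrix.vecMulVec θ.ofLp θ.ofLp =
      Matrix.vecMulVec θ.ofLp θ.ofLp := by
    rw [Matrix.vecMulVec_mul_vecMulVec, hdot, one_smul]
  have hs : 0 ≤ √(1 + r * v) - 1 := by
    rw [sub_nonneg, Real.one_le_sqrt]; linarith
  have hpsd : (1 + (√(1 + r * v) - 1) • Matrix.vecMulVec θ.ofLp θ.ofLp :
      Matrix (Fin p) (Fin p) ℝ).PosSemidef := by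
    refine Matrix.PosSemidef.one.add (Matrix.PosSemidef.smul ?_ hs)
    simpa using Matrix.posSemidef_vecMulVec_self_star θ.ofLp
  refine CFC.sqrt_unique ?_ ?_
  · have h2 : √(1 + r * v) * √(1 + r * v) = 1 + r * v := Real.mul_self_sqrt (by linarith)
    rw [spikedCov, mul_add, add_mul, add_mul, smul_mul_smul_comm, hproj, mul_one, one_mul, mul_one,
      one_pow, one_smul, add_assoc, ← add_smul, ← add_smul]
    congr 2
    linear_combination h2
  · exact hpsd.nonneg

open scoped MatrixOrder in
lemma map_sum_smul_eq_multivariateGaussian {p : ℕ} [NeZero p]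
    (b : OrthonormalBasis (Fin p) ℝ (EuclideanSpace ℝ (Fin p))) (r v : ℝ) (h : 0 ≤ r * v) :
    (Measure.pi fun _ : Fin p => gaussianReal 0 1).map
        (fun y => ∑ j, (spikeScale (r * v) j * y j) • b j) =
      multivariateGaussian 0 (spikedCov 1 (b 0) r v) := by
  rw [multivariateGaussian, stdGaussian_eq_map_pi_orthonormalBasis b,
    Measure.map_map (by fun_prop) (by fun_prop), sqrt_spikedCov _ (b.norm_eq_one 0) _ _ h]
  congr 1
  ext1 y
  have key : ∀ x : EuclideanSpace ℝ (Fin p), Matrix.toEuclideanCLM (𝕜 := ℝ)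
      (1 + (√(1 + r * v) - 1) • Matrix.vecMulVec (b 0).ofLp (b 0).ofLp) x =
      x + ((√(1 + r * v) - 1) * inner ℝ (b 0) x) • b 0 := by
    intro x
    ext i
    simp [Matrix.vecMulVec_mulVec, PiLp.inner_apply, dotProduct, mul_comm, mul_left_comm]
  rw [Function.comp_apply, zero_add, key, inner_sum]
  simp only [inner_smul_right, b.inner_eq_ite, mul_ite, mul_one, mul_zero]
  rw [Finset.sum_ite_eq, if_pos (Finset.mem_univ _), ← Finset.add_sum_erase _ _ (Finset.mem_univ 0),
    ← Finset.add_sum_erase Finset.univ (fun i => y i • b i) (Finset.mem_univ 0)]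
  have : ∀ j ∈ Finset.univ.erase (0 : Fin p), (spikeScale (r * v) j * y j) • b j = y j • b j := by
    intro j hj
    rw [spikeScale, if_neg (Finset.ne_of_mem_erase hj), one_mul]
  rw [Finset.sum_congr rfl this, spikeScale, if_pos rfl]
  module

/-- The law of the sample built from the array is the spiked normal law. -/
lemma map_arraySample {p : ℕ} [NeZero p]
    (b : OrthonormalBasis (Fin p) ℝ (EuclideanSpace ℝ (Fin p))) (r v : ℝ) (h : 0 ≤ r * v) (n : ℕ) :
    (arrayLaw p).map (arraySample b (r * v) n) = spikedLaw n 0 1 (b 0) r v := by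
  have hinj : Function.Injective fun a : Fin n × Fin p => ((a.1 : ℕ), a.2) := by
    rintro ⟨i, j⟩ ⟨i', j'⟩ h
    simpa [Fin.ext_iff] using h
  have hpi := Measure.pi_map_pi (μ := fun _ : Fin n => Measure.pi fun _ : Fin p => gaussianReal 0 1)
    (f := fun _ y => ∑ j, (spikeScale (r * v) j * y j) • b j)
    (hμ := fun _ => by rw [map_sum_smul_eq_multivariateGaussian b r v h]; infer_instance)
    (fun _ => Measurable.aemeasurable (by fun_prop))
  simp only [map_sum_smul_eq_multivariateGaussian b r v h] at hpi
  rw [spikedLaw, ← hpi, ← map_arrayLaw_of_injective₂ hinj,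
    Measure.map_map (by fun_prop) (by fun_prop)]
  rfl

lemma measurable_arraySample {p : ℕ} [NeZero p]
    (b : OrthonormalBasis (Fin p) ℝ (EuclideanSpace ℝ (Fin p))) (t : ℝ) (n : ℕ) :
    Measurable (arraySample b t n) := by
  unfold arraySample; fun_prop

/-! ### Empirical covariances of the columns -/

/-- The empirical covariance of two columns of data. -/
noncomputable def columnCov {n : ℕ} (x y : Fin n → ℝ) : ℝ :=
  (n : ℝ)⁻¹ * ∑ i, (x i - (n : ℝ)⁻¹ * ∑ l, x l) * (y i - (n : ℝ)⁻¹ * ∑ l, y l)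

/-- The first `n` entries of the column `j` of an array. -/
def column {p : ℕ} (n : ℕ) (ω : ℕ × Fin p → ℝ) (j : Fin p) : Fin n → ℝ := fun i => ω (i, j)

lemma columnCov_comm {n : ℕ} (x y : Fin n → ℝ) : columnCov x y = columnCov y x := by
  simp only [columnCov, mul_comm]

lemma columnCov_eq {n : ℕ} (hn : n ≠ 0) (x y : Fin n → ℝ) :
    columnCov x y = (∑ i, x i * y i) / n - (∑ i, x i) / n * ((∑ i, y i) / n) := by
  have hn' : (n : ℝ) ≠ 0 := Nat.cast_ne_zero.2 hn
  have : ∀ a c : ℝ, ∑ i, (x i - a) * (y i - c) =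
      ∑ i, x i * y i - a * ∑ i, y i - c * ∑ i, x i + n * (a * c) := by
    intro a c
    simp only [sub_mul, mul_sub, Finset.sum_sub_distrib, ← Finset.mul_sum, ← Finset.sum_mul]
    simp
    ring
  rw [columnCov, this]
  field_simp
  ring

/-- A centred column sums to zero, so centring one factor is enough. The covariance thus becomes a
linear form in the raw column `y`, with a direction depending on `x` alone. -/
lemma columnCov_eq' {n : ℕ} (hn : n ≠ 0) (x y : Fin n → ℝ) :
    n * columnCov x y = ∑ i, (x i - (n : ℝ)⁻¹ * ∑ l, x l) * y i := by
  have hn' : (n : ℝ) ≠ 0 := Nat.cast_ne_zero.2 hn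
  rw [columnCov_eq hn]
  simp only [sub_mul, Finset.sum_sub_distrib, ← Finset.mul_sum]
  field_simp

lemma inner_sampleMean_arraySample {p : ℕ} [NeZero p]
    (b : OrthonormalBasis (Fin p) ℝ (EuclideanSpace ℝ (Fin p))) (t : ℝ) (n : ℕ)
    (ω : ℕ × Fin p → ℝ) (i : Fin n) (j : Fin p) :
    inner ℝ (b j) (arraySample b t n ω i - sampleMean (arraySample b t n ω)) =
      spikeScale t j * (column n ω j i - (n : ℝ)⁻¹ * ∑ l, column n ω j l) := by
  have h : ∀ i, inner ℝ (b j) (arraySample b t n ω i) = spikeScale t j * column n ω j i := by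
    intro i
    simp [arraySample, inner_sum, inner_smul_right, b.inner_eq_ite, column]
  rw [inner_sub_right, h, sampleMean, inner_smul_right, inner_sum]
  simp only [h, ← Finset.mul_sum]
  ring

/-- The sample covariance matrix in terms of the array. -/
lemma dotProduct_sampleCov_arraySample {p : ℕ} [NeZero p]
    (b : OrthonormalBasis (Fin p) ℝ (EuclideanSpace ℝ (Fin p))) (t : ℝ) (n : ℕ)
    (ω : ℕ × Fin p → ℝ) (j k : Fin p) :
    (b j).ofLp ⬝ᵥ Matrix.mulVec (sampleCov (arraySample b t n ω)) (b k).ofLp =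
      spikeScale t j * spikeScale t k * columnCov (column n ω j) (column n ω k) := by
  have hdot : ∀ x : EuclideanSpace ℝ (Fin p),
      (b j).ofLp ⬝ᵥ Matrix.mulVec (Matrix.vecMulVec x.ofLp x.ofLp) (b k).ofLp =
        inner ℝ (b j) x * inner ℝ (b k) x := by
    intro x
    simp only [Matrix.vecMulVec_mulVec, PiLp.inner_apply, dotProduct, Pi.smul_apply,
      MulOpposite.smul_eq_mul_unop, MulOpposite.unop_op, Finset.sum_mul, RCLike.inner_apply,
      conj_trivial]
    refine Finset.sum_congr rfl fun i _ => ?_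
    ring_nf
  rw [sampleCov, Matrix.smul_mulVec, dotProduct_smul, Matrix.sum_mulVec, dotProduct_sum]
  simp only [hdot, inner_sampleMean_arraySample]
  rw [columnCov, smul_eq_mul, mul_left_comm, Finset.mul_sum (s := Finset.univ)
    (a := spikeScale t j * spikeScale t k)]
  congr 1
  refine Finset.sum_congr rfl fun i _ => ?_
  ring

/-! ### Strong law of large numbers for the array -/

/-- The law of the array is invariant under permutations of the rows. -/
lemma measurePreserving_swap_rows (p : ℕ) (i : ℕ) :
    MeasurePreserving (fun (ω : ℕ × Fin p → ℝ) q => ω (Equiv.swap 0 i q.1, q.2))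
      (arrayLaw p) (arrayLaw p) where
  measurable := by fun_prop
  map_eq := by
    have hinj : Function.Injective fun q : ℕ × Fin p => (Equiv.swap 0 i q.1, q.2) := by
      rintro ⟨a, b⟩ ⟨c, d⟩ h
      simpa using h
    exact Measure.map_infinitePi_infinitePi_of_inj (P := fun _ => gaussianReal 0 1) hinj

lemma iIndepFun_eval_arrayLaw (p : ℕ) :
    iIndepFun (fun (q : ℕ × Fin p) (ω : ℕ × Fin p → ℝ) => ω q) (arrayLaw p) :=
  iIndepFun_infinitePi (P := fun _ : ℕ × Fin p => gaussianReal 0 1) (X := fun _ x => x)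
    (by fun_prop)

lemma measurePreserving_eval_arrayLaw {p : ℕ} (q : ℕ × Fin p) :
    MeasurePreserving (fun ω : ℕ × Fin p → ℝ => ω q) (arrayLaw p) (gaussianReal 0 1) :=
  measurePreserving_eval_infinitePi _ q

lemma memLp_eval_arrayLaw {p : ℕ} (q : ℕ × Fin p) :
    MemLp (fun ω : ℕ × Fin p → ℝ => ω q) 2 (arrayLaw p) :=
  (IsGaussian.memLp_two_id (μ := gaussianReal 0 1)).comp_measurePreserving
    (measurePreserving_eval_arrayLaw q)

lemma integral_eval_arrayLaw {p : ℕ} (q : ℕ × Fin p) :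
    ∫ ω, ω q ∂(arrayLaw p) = 0 := by
  have h := integral_map (μ := arrayLaw p) (measurePreserving_eval_arrayLaw q).measurable.aemeasurable
    (f := fun x => x) (by fun_prop)
  rw [(measurePreserving_eval_arrayLaw q).map_eq] at h
  rw [← h, integral_id_gaussianReal]

lemma integral_mul_eval_arrayLaw {p : ℕ} (i : ℕ) (j k : Fin p) :
    ∫ ω, ω (i, j) * ω (i, k) ∂(arrayLaw p) = if j = k then 1 else 0 := by
  split_ifs with h
  · subst h
    have h := integral_map (μ := arrayLaw p) (measurePreserving_eval_arrayLaw (i, j)).measurable.aemeasurable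
      (f := fun x => x * x) (by fun_prop)
    rw [(measurePreserving_eval_arrayLaw (i, j)).map_eq] at h
    rw [← h]
    have hv := variance_id_gaussianReal (μ := 0) (v := 1)
    rw [variance_eq_integral measurable_id.aemeasurable] at hv
    simpa [pow_two] using hv
  · have hi := (iIndepFun_eval_arrayLaw p).indepFun (i := (i, j)) (j := (i, k)) (by simpa using h)
    rw [hi.integral_fun_mul_eq_mul_integral (memLp_eval_arrayLaw _).1 (memLp_eval_arrayLaw _).1,
      integral_eval_arrayLaw,
      zero_mul]

/-- The strong law of large numbers for functions of the first row of the array. -/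
lemma tendsto_average_of_row {p : ℕ} (g : (Fin p → ℝ) → ℝ) (hg : Measurable g)
    (hint : Integrable (fun ω => g fun j => ω (0, j)) (arrayLaw p)) :
    ∀ᵐ ω ∂(arrayLaw p), Tendsto (fun n : ℕ => (∑ i : Fin n, g fun j => ω (i, j)) / n) atTop
      (𝓝 (∫ ω, g (fun j => ω (0, j)) ∂(arrayLaw p))) := by
  have h := strong_law_ae_real (μ := arrayLaw p) (fun i ω => g fun j => ω (i, j)) hint ?_ ?_
  · filter_upwards [h] with ω hω
    simpa only [Fin.sum_univ_eq_sum_range fun i => g fun j => ω (i, j)] using hω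
  · intro i i' hne
    have := (iIndepFun_eval_arrayLaw p).indepFun_finset
      (Finset.univ.image fun j : Fin p => (i, j)) (Finset.univ.image fun j : Fin p => (i', j))
      (by
        rw [Finset.disjoint_left]
        simp only [Finset.mem_image, Finset.mem_univ, true_and]
        rintro _ ⟨j, rfl⟩ ⟨j', h⟩
        simp only [Prod.mk.injEq] at h
        exact hne h.1.symm) (by fun_prop)
    have hm : ∀ i : ℕ, Measurable
        fun (a : (Finset.univ.image fun j : Fin p => (i, j)) → ℝ) =>
          g fun j => a ⟨(i, j), by simp⟩ := fun i =>
      hg.comp (measurable_pi_lambda _ fun j => measurable_pi_apply _)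
    exact this.comp (hm i) (hm i')
  · intro i
    have hT := measurePreserving_swap_rows p i
    have hm : Measurable fun ω : ℕ × Fin p → ℝ => g fun j => ω (0, j) := hg.comp (by fun_prop)
    have hm' : Measurable fun ω : ℕ × Fin p → ℝ => g fun j => ω (i, j) := hg.comp (by fun_prop)
    refine ⟨hm'.aemeasurable, hm.aemeasurable, ?_⟩
    conv_rhs => rw [← hT.map_eq, Measure.map_map hm hT.measurable]
    simp [Function.comp_def]

/-- The empirical covariance matrix of the array converges to the identity matrix. -/
lemma tendsto_columnCov (p : ℕ) :
    ∀ᵐ ω ∂(arrayLaw p), ∀ j k : Fin p,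
      Tendsto (fun n : ℕ => columnCov (column n ω j) (column n ω k)) atTop
        (𝓝 (if j = k then 1 else 0)) := by
  rw [ae_all_iff]
  intro j
  rw [ae_all_iff]
  intro k
  have hi : ∀ q, Integrable (fun ω => ω q) (arrayLaw p) := fun q =>
    (memLp_eval_arrayLaw q).integrable one_le_two
  have h1 := tendsto_average_of_row (p := p) (fun x => x j * x k) (by fun_prop)
    ((memLp_eval_arrayLaw (0, j)).integrable_mul (memLp_eval_arrayLaw (0, k)))
  have h2 := tendsto_average_of_row (p := p) (fun x => x j) (by fun_prop) (hi (0, j))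
  have h3 := tendsto_average_of_row (p := p) (fun x => x k) (by fun_prop) (hi (0, k))
  filter_upwards [h1, h2, h3] with ω h1 h2 h3
  rw [integral_eval_arrayLaw] at h2 h3
  rw [integral_mul_eval_arrayLaw] at h1
  have h := h1.sub (h2.mul h3)
  rw [mul_zero, sub_zero] at h
  refine h.congr' ?_
  filter_upwards [eventually_ne_atTop 0] with n hn
  rw [columnCov_eq hn]
  rfl

/-! ### Krylov determinants: no eigenvector is orthogonal to the spike -/

/-- The Krylov matrix with columns `e₀, M e₀, …, M ^ (p - 1) e₀`. -/
def krylov {R : Type*} [CommRing R] {p : ℕ} [NeZero p] (M : Matrix (Fin p) (Fin p) R) :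
    Matrix (Fin p) (Fin p) R :=
  Matrix.of fun j k => (M ^ (k : ℕ)) j 0

/-- Since `y' M ^ k e₀ = l ^ k * y 0 = 0` for all `k`, the vector `y` annihilates every column of
the Krylov matrix. -/
lemma eq_zero_of_det_krylov_ne_zero {p : ℕ} [NeZero p] {M : Matrix (Fin p) (Fin p) ℝ}
    (hM : M.IsSymm) (hdet : (krylov M).det ≠ 0) {y : Fin p → ℝ} {l : ℝ}
    (hy : Matrix.mulVec M y = l • y) (h0 : y 0 = 0) : y = 0 := by
  have hpow : ∀ k : ℕ, Matrix.vecMul y (M ^ k) = l ^ k • y := by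
    intro k
    induction k with
    | zero => simp
    | succ k ih =>
      rw [pow_succ, ← Matrix.vecMul_vecMul, ih, Matrix.smul_vecMul, ← hM.eq,
        Matrix.vecMul_transpose, hy, smul_smul, pow_succ]
  refine Matrix.eq_zero_of_vecMul_eq_zero hdet ?_
  ext k
  have h : Matrix.vecMul y (krylov M) k = Matrix.vecMul y (M ^ (k : ℕ)) 0 := rfl
  simp [h, hpow, h0]

/-- For an upper Hessenberg `M`, each multiplication by `M` moves the last nonzero coordinate of `M
^ k e₀` down by exactly one, so the Krylov matrix is triangular with nonzero diagonal. -/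
lemma det_krylov_ne_zero {p : ℕ} [NeZero p] {M : Matrix (Fin p) (Fin p) ℝ}
    (h0 : ∀ j k : Fin p, (k : ℕ) + 1 < j → M j k = 0)
    (h1 : ∀ j k : Fin p, (j : ℕ) = k + 1 → M j k ≠ 0) : (krylov M).det ≠ 0 := by
  have key : ∀ k : ℕ, ∀ j : Fin p,
      (k < j → (M ^ k) j 0 = 0) ∧ ((j : ℕ) = k → (M ^ k) j 0 ≠ 0) := by
    intro k
    induction k with
    | zero =>
      intro j
      constructor
      · intro hj
        rw [pow_zero, Matrix.one_apply_ne]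
        rintro rfl
        simp at hj
      · intro hj
        have : j = 0 := Fin.ext (by simpa using hj)
        simp [this]
    | succ k ih =>
      intro j
      rw [pow_succ', Matrix.mul_apply]
      constructor
      · intro hj
        refine Finset.sum_eq_zero fun l _ => ?_
        rcases lt_or_ge k (l : ℕ) with hl | hl
        · rw [(ih l).1 hl, mul_zero]
        · rw [h0 j l (by omega), zero_mul]
      · intro hj
        have hk : k < p := by omega
        rw [Finset.sum_eq_single (⟨k, hk⟩ : Fin p)]
        · exact mul_ne_zero (h1 _ _ hj) ((ih ⟨k, hk⟩).2 rfl)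
        · intro l _ hl
          have hl' : (l : ℕ) ≠ k := fun h => hl (Fin.ext h)
          rcases lt_or_gt_of_ne hl' with hl' | hl'
          · rw [h0 j l (by omega), zero_mul]
          · rw [(ih l).1 hl', mul_zero]
        · simp
  have htri : (krylov M).IsUpperTriangular := by
    intro j k hjk
    exact (key k j).1 hjk
  rw [Matrix.det_of_isUpperTriangular htri, Finset.prod_ne_zero_iff]
  intro j _
  exact (key j j).2 rfl

/-- The covariance matrix of the columns of a data matrix, scaled by `c`. -/
noncomputable def scaledCov {n p : ℕ} (c : Fin p → ℝ) (x : Fin n × Fin p → ℝ) :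
    Matrix (Fin p) (Fin p) ℝ :=
  Matrix.of fun j k => c j * c k * columnCov (fun i => x (i, j)) (fun i => x (i, k))

lemma scaledCov_isSymm {n p : ℕ} (c : Fin p → ℝ) (x : Fin n × Fin p → ℝ) :
    (scaledCov c x).IsSymm := by
  ext j k
  simp [scaledCov, columnCov_comm, mul_comm]

/-- The polynomial whose value at a data matrix is the Krylov determinant of its covariance
matrix. -/
noncomputable def krylovPolynomial (n : ℕ) {p : ℕ} [NeZero p] (c : Fin p → ℝ) :
    MvPolynomial (Fin n × Fin p) ℝ :=
  let m : Fin p → MvPolynomial (Fin n × Fin p) ℝ := fun j =>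
    MvPolynomial.C (n : ℝ)⁻¹ * ∑ l, MvPolynomial.X (l, j)
  (krylov (Matrix.of fun j k => MvPolynomial.C (c j * c k) * (MvPolynomial.C (n : ℝ)⁻¹ *
    ∑ i, (MvPolynomial.X (i, j) - m j) * (MvPolynomial.X (i, k) - m k)))).det

lemma eval_krylovPolynomial (n : ℕ) {p : ℕ} [NeZero p] (c : Fin p → ℝ) (x : Fin n × Fin p → ℝ) :
    MvPolynomial.eval x (krylovPolynomial n c) = (krylov (scaledCov c x)).det := by
  have hmap : ∀ M : Matrix (Fin p) (Fin p) (MvPolynomial (Fin n × Fin p) ℝ),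
      (MvPolynomial.eval x).mapMatrix (krylov M) = krylov ((MvPolynomial.eval x).mapMatrix M) := by
    intro M
    ext j k
    simp only [krylov, RingHom.mapMatrix_apply, Matrix.map_apply, Matrix.of_apply]
    rw [← Matrix.map_apply (f := MvPolynomial.eval x), Matrix.map_pow]
  have hcov : ∀ M : Matrix (Fin p) (Fin p) (MvPolynomial (Fin n × Fin p) ℝ),
      (∀ j k, MvPolynomial.eval x (M j k) = scaledCov c x j k) →
      (MvPolynomial.eval x).mapMatrix M = scaledCov c x := by
    intro M hM
    ext j k
    exact hM j k
  rw [krylovPolynomial, RingHom.map_det, hmap, hcov]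
  intro j k
  simp [scaledCov, columnCov]

lemma krylovPolynomial_ne_zero {n p : ℕ} [NeZero p] (hn : p < n) (c : Fin p → ℝ)
    (hc : ∀ j, c j ≠ 0) : krylovPolynomial n c ≠ 0 := by
  intro h
  have hn0 : (n : ℝ) ≠ 0 := by
    rw [Nat.cast_ne_zero]; omega
  -- The witness has columns `e_j - e_{j+1}`: each sums to zero and only neighbouring columns
  -- overlap, so its covariance is tridiagonal with nonzero subdiagonal. The last column needs `p <
  -- n`.
  let e₁ : Fin p → Fin n := fun j => ⟨j, by omega⟩
  let e₂ : Fin p → Fin n := fun j => ⟨j + 1, by omega⟩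
  let x : Fin n × Fin p → ℝ := fun a =>
    (if a.1 = e₁ a.2 then 1 else 0) - (if a.1 = e₂ a.2 then 1 else 0)
  have x_apply : ∀ i j, x (i, j) = (if i = e₁ j then 1 else 0) - (if i = e₂ j then 1 else 0) :=
    fun _ _ => rfl
  have hx := eval_krylovPolynomial n c x
  rw [h, map_zero] at hx
  have hsum : ∀ j, ∑ i, x (i, j) = 0 := by
    intro j
    simp [x_apply, Finset.sum_sub_distrib]
  have hcov : ∀ j k : Fin p, (k : ℕ) < j → scaledCov c x j k =
      c j * c k * (n : ℝ)⁻¹ * -(if (j : ℕ) = k + 1 then 1 else 0) := by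
    intro j k hjk
    rw [scaledCov, Matrix.of_apply, columnCov]
    simp only [hsum, mul_zero, sub_zero]
    have : ∑ i, x (i, j) * x (i, k) = -(if (j : ℕ) = k + 1 then 1 else 0) := by
      simp only [x_apply, sub_mul, ite_mul, one_mul, zero_mul, Finset.sum_sub_distrib,
        Finset.sum_ite_eq', Finset.mem_univ, if_true, e₁, e₂, Fin.mk.injEq]
      have h1 : ¬ (j : ℕ) = k := by omega
      have h2 : ¬ (j : ℕ) + 1 = k := by omega
      simp [h1, h2]
    rw [this]
    ring
  refine det_krylov_ne_zero (M := scaledCov c x) ?_ ?_ hx.symm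
  · intro j k hjk
    rw [hcov j k (by omega), if_neg (by omega)]
    simp
  · intro j k hjk
    rw [hcov j k (by omega), if_pos hjk]
    simp [hc, hn0]

/-- Almost surely, the Krylov determinant of the covariance matrix is nonzero. -/
lemma ae_det_krylov_ne_zero {n p : ℕ} [NeZero p] (hn : p < n) (c : Fin p → ℝ)
    (hc : ∀ j, c j ≠ 0) :
    ∀ᵐ ω ∂(arrayLaw p),
      (krylov (scaledCov c fun a : Fin n × Fin p => ω ((a.1 : ℕ), a.2))).det ≠ 0 := by
  have hinj : Function.Injective fun a : Fin n × Fin p => ((a.1 : ℕ), a.2) := by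
    rintro ⟨i, j⟩ ⟨i', j'⟩ h
    simpa [Fin.ext_iff] using h
  have h := measure_pi_zeros_eq_zero (gaussianReal 0 1) _ (krylovPolynomial_ne_zero hn c hc)
  rw [← map_arrayLaw_of_injective hinj, Measure.map_apply (by fun_prop)
    (isClosed_eq (MvPolynomial.continuous_eval _) continuous_const).measurableSet] at h
  rw [ae_iff]
  simpa [eval_krylovPolynomial] using h

/-! ### Eigenvalue perturbation and Gram-Schmidt bases -/

section LinearAlgebra

variable {E : Type*} [NormedAddCommGroup E] [InnerProductSpace ℝ E] {p : ℕ}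

lemma inner_map_self_le {T : E →ₗ[ℝ] E} (hT : T.IsSymmetric) (e : OrthonormalBasis (Fin p) ℝ E)
    {l : Fin p → ℝ} (he : ∀ j, T (e j) = l j • e j) {L : ℝ} (hL : ∀ j, l j ≤ L) {y : E}
    (hy : ‖y‖ = 1) : inner ℝ y (T y) ≤ L := by
  rw [← e.sum_inner_mul_inner]
  have h1 : ∀ j, inner ℝ y (e j) * inner ℝ (e j) (T y) = l j * inner ℝ (e j) y ^ 2 := by
    intro j
    rw [← hT, he, inner_smul_left, real_inner_comm]
    simp only [conj_trivial]
    ring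
  simp only [h1]
  calc ∑ j, l j * inner ℝ (e j) y ^ 2 ≤ ∑ j, L * inner ℝ (e j) y ^ 2 :=
        Finset.sum_le_sum fun j _ => mul_le_mul_of_nonneg_right (hL j) (sq_nonneg _)
    _ = L := by rw [← Finset.mul_sum, e.sum_sq_inner_right, hy]; simp

lemma sum_eq_sum_inner_map {T : E →ₗ[ℝ] E} (e b : OrthonormalBasis (Fin p) ℝ E)
    {l : Fin p → ℝ} (he : ∀ j, T (e j) = l j • e j) :
    ∑ j, l j = ∑ j, inner ℝ (b j) (T (b j)) := by
  rw [← LinearMap.trace_eq_sum_inner T b, LinearMap.trace_eq_sum_inner T e]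
  simp [he, inner_smul_right]

/-- The diagonal form is at least `‖y‖² = 1`, and each of the `p ^ 2` entries contributes an error
of at most `ε`, the coordinates of `y` being at most one in absolute value. -/
lemma le_inner_map_self {T : E →ₗ[ℝ] E} (b : OrthonormalBasis (Fin p) ℝ E)
    {m : Fin p → ℝ} (hm : ∀ j, 1 ≤ m j) {ε : ℝ}
    (hε : ∀ j k, |inner ℝ (b j) (T (b k)) - if j = k then m j else 0| ≤ ε) {y : E}
    (hy : ‖y‖ = 1) : 1 - p ^ 2 * ε ≤ inner ℝ y (T y) := by
  have hexp : inner ℝ y (T y) = ∑ j, ∑ k, inner ℝ (b j) y * inner ℝ (b k) y *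
      inner ℝ (b j) (T (b k)) := by
    conv_lhs => rw [← b.sum_repr' y]
    simp only [map_sum, map_smul, sum_inner, inner_sum, inner_smul_left, inner_smul_right,
      conj_trivial]
    rw [Finset.sum_comm]
    simp only [Finset.mul_sum, mul_assoc, mul_left_comm]
  have hle : ∀ j, |inner ℝ (b j) y| ≤ 1 := by
    intro j
    simpa [hy, b.norm_eq_one] using abs_real_inner_le_norm (b j) y
  have hterm : ∀ j k, (if j = k then m j * inner ℝ (b j) y ^ 2 else 0) - ε ≤
      inner ℝ (b j) y * inner ℝ (b k) y * inner ℝ (b j) (T (b k)) := by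
    intro j k
    have h1 : |inner ℝ (b j) y * inner ℝ (b k) y *
        (inner ℝ (b j) (T (b k)) - if j = k then m j else 0)| ≤ ε := by
      rw [abs_mul, abs_mul]
      calc _ ≤ (1 * 1) * ε := mul_le_mul (mul_le_mul (hle j) (hle k) (abs_nonneg _) zero_le_one)
              (hε j k) (abs_nonneg _) (by norm_num)
        _ = ε := by ring
    have h2 := (abs_le.1 h1).1
    split_ifs at h2 ⊢ with h
    · subst h; nlinarith
    · nlinarith
  have hsum : ∑ j, ∑ k : Fin p, ((if j = k then m j * inner ℝ (b j) y ^ 2 else 0) - ε) =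
      ∑ j, m j * inner ℝ (b j) y ^ 2 - p ^ 2 * ε := by
    simp only [Finset.sum_sub_distrib, Finset.sum_ite_eq, Finset.mem_univ, if_true]
    simp
    ring
  have hone : 1 ≤ ∑ j, m j * inner ℝ (b j) y ^ 2 := by
    calc (1 : ℝ) = ∑ j, inner ℝ (b j) y ^ 2 := by rw [b.sum_sq_inner_right, hy]; simp
      _ ≤ _ := Finset.sum_le_sum fun j _ => le_mul_of_one_le_left (sq_nonneg _) (hm j)
  rw [hexp]
  calc 1 - p ^ 2 * ε ≤ _ := by linarith
    _ ≤ _ := hsum.symm.le.trans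
      (Finset.sum_le_sum fun j _ => Finset.sum_le_sum fun k _ => hterm j k)

/-- Perturbation bound for the decreasing eigenvalues of a symmetric map that is close to
`diag (m, 1, …, 1)` with `1 ≤ m`. -/
lemma abs_eigenvalue_sub_le [NeZero p] {T : E →ₗ[ℝ] E} (hT : T.IsSymmetric)
    (e b : OrthonormalBasis (Fin p) ℝ E) {l : Fin p → ℝ} (hl : ∀ j, l j ≤ l 0)
    (he : ∀ j, T (e j) = l j • e j) {m : Fin p → ℝ} (hm0 : 1 ≤ m 0) (hm : ∀ j ≠ 0, m j = 1)
    {ε : ℝ} (hε : ∀ j k, |inner ℝ (b j) (T (b k)) - if j = k then m j else 0| ≤ ε) (j : Fin p) :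
    |l j - m j| ≤ (p + p ^ 3) * ε := by
  have hε0 : 0 ≤ ε := (abs_nonneg _).trans (hε 0 0)
  have hp : (1 : ℝ) ≤ p := Nat.one_le_cast.2 NeZero.one_le
  have hm1 : ∀ j, 1 ≤ m j := by
    intro j
    rcases eq_or_ne j 0 with rfl | hj
    · exact hm0
    · rw [hm j hj]
  -- Lower bounds suffice: the top eigenvalue dominates the Rayleigh quotient at `b 0`, and every
  -- other one is itself a Rayleigh quotient.
  have hlow : ∀ j, m j - p ^ 2 * ε ≤ l j := by
    intro j
    rcases eq_or_ne j 0 with rfl | hj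
    · have h1 := inner_map_self_le hT e he hl (b.norm_eq_one 0)
      have h2 := (abs_le.1 (hε 0 0)).1
      rw [if_pos rfl] at h2
      have : ε ≤ p ^ 2 * ε := le_mul_of_one_le_left hε0 (one_le_pow₀ hp)
      linarith
    · have h1 := le_inner_map_self b hm1 hε (e.norm_eq_one j)
      rw [he, inner_smul_right, real_inner_self_eq_norm_sq, e.norm_eq_one] at h1
      rw [hm j hj]
      linarith
  have htr : ∑ j, (l j - m j) ≤ p * ε := by
    rw [Finset.sum_sub_distrib, sum_eq_sum_inner_map e b he, ← Finset.sum_sub_distrib]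
    calc _ ≤ ∑ _j : Fin p, ε := Finset.sum_le_sum fun j _ => by
            have := (abs_le.1 (hε j j)).2
            rwa [if_pos rfl] at this
      _ = p * ε := by simp
  -- Upper bounds come from the trace: these terms are nonnegative with sum at most `(p + p ^ 3) *
  -- ε`, so each is bounded by that.
  have hnn : l j - m j + p ^ 2 * ε ≤ ∑ j, (l j - m j + p ^ 2 * ε) :=
    Finset.single_le_sum (f := fun j => l j - m j + p ^ 2 * ε)
      (fun k _ => by linarith [hlow k]) (Finset.mem_univ j)
  rw [Finset.sum_add_distrib] at hnn
  simp only [Finset.sum_const, Finset.card_univ, Fintype.card_fin, nsmul_eq_mul] at hnn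
  have h3 : 0 ≤ p ^ 2 * ε := by positivity
  have h4 : (p : ℝ) ^ 2 * ε ≤ p ^ 3 * ε :=
    mul_le_mul_of_nonneg_right (pow_le_pow_right₀ hp (by norm_num)) hε0
  have h5 : 0 ≤ p * ε := by positivity
  rw [abs_le]
  constructor
  · linarith [hlow j]
  · nlinarith

/-- An eigenspace of dimension two would contain a nonzero vector orthogonal to `θ`. -/
lemma eigenvalue_injective_of_forall {T : E →ₗ[ℝ] E} {θ : E}
    (hθ : ∀ (y : E) (l : ℝ), T y = l • y → inner ℝ θ y = 0 → y = 0)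
    (e : OrthonormalBasis (Fin p) ℝ E) {l : Fin p → ℝ} (he : ∀ j, T (e j) = l j • e j) :
    Function.Injective l := by
  intro i j hij
  by_contra hne
  have h := hθ (inner ℝ θ (e j) • e i - inner ℝ θ (e i) • e j) (l i)
    (by
      rw [map_sub, map_smul, map_smul, he, he, ← hij]
      module)
    (by
      rw [inner_sub_right, inner_smul_right, inner_smul_right]
      ring)
  have h1 := congrArg (fun z => inner ℝ (e i) z) h
  simp only [inner_sub_right, inner_smul_right, e.inner_eq_ite, inner_zero_right] at h1
  simp only [if_true, if_neg hne, mul_one, mul_zero, sub_zero] at h1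
  have h2 := e.norm_eq_one j
  rw [hθ (e j) (l j) (he j) h1, norm_zero] at h2
  exact zero_ne_one h2

/-- Distinct eigenvalues make the `u j` orthonormal, and `θ` has a nonzero component along the
vector `u 0` that it replaces. -/
lemma linearIndependent_update [NeZero p] {T : E →ₗ[ℝ] E} (hT : T.IsSymmetric) {θ : E}
    (hθ : ∀ (y : E) (l : ℝ), T y = l • y → inner ℝ θ y = 0 → y = 0)
    {l : Fin p → ℝ} (hl : Function.Injective l) {u : Fin p → E} (hu1 : ∀ j, ‖u j‖ = 1)
    (hu : ∀ j, T (u j) = l j • u j) : LinearIndependent ℝ (Function.update u 0 θ) := by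
  have horth : ∀ i j, i ≠ j → inner ℝ (u i) (u j) = 0 := by
    intro i j hij
    have h := hT (u i) (u j)
    rw [hu, hu, inner_smul_left, inner_smul_right] at h
    have h2 : (l i - l j) * inner ℝ (u i) (u j) = 0 := by
      simp only [conj_trivial] at h
      linarith
    exact (mul_eq_zero.1 h2).resolve_left (sub_ne_zero.2 fun h => hij (hl h))
  rw [Fintype.linearIndependent_iff]
  intro g hg
  rw [← Finset.add_sum_erase _ _ (Finset.mem_univ 0)] at hg
  have hrest : ∑ j ∈ Finset.univ.erase (0 : Fin p), g j • Function.update u 0 θ j =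
      ∑ j ∈ Finset.univ.erase (0 : Fin p), g j • u j :=
    Finset.sum_congr rfl fun j hj => by rw [Function.update_of_ne (Finset.ne_of_mem_erase hj)]
  rw [hrest, Function.update_self] at hg
  have h0 : g 0 = 0 := by
    have h := congrArg (fun z => inner ℝ (u 0) z) hg
    simp only [inner_add_right, inner_smul_right, inner_sum, inner_zero_right] at h
    rw [Finset.sum_eq_zero fun j hj => by
      rw [horth 0 j (Finset.ne_of_mem_erase hj).symm, mul_zero], add_zero] at h
    refine (mul_eq_zero.1 h).resolve_right fun h' => ?_
    rw [real_inner_comm] at h'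
    have h1 := hu1 0
    rw [hθ (u 0) (l 0) (hu 0) h', norm_zero] at h1
    exact zero_ne_one h1
  intro i
  rcases eq_or_ne i 0 with rfl | hi
  · exact h0
  rw [h0, zero_smul, zero_add] at hg
  have h := congrArg (fun z => inner ℝ (u i) z) hg
  simp only [inner_smul_right, inner_sum, inner_zero_right] at h
  rw [Finset.sum_eq_single i (fun j _ hj => by rw [horth i j hj.symm, mul_zero])
    (fun h => absurd (Finset.mem_erase.2 ⟨hi, Finset.mem_univ i⟩) h),
    real_inner_self_eq_norm_sq, hu1] at h
  simpa using h

/-- By Parseval both sides equal `‖z‖² - ⟨b 0, z⟩²`, as Gram-Schmidt keeps a first vector of norm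
one. -/
lemma sum_sq_inner_gramSchmidtNormed [NeZero p] (b : OrthonormalBasis (Fin p) ℝ E) {f : Fin p → E}
    (hf : LinearIndependent ℝ f) (h0 : f 0 = b 0) (z : E) :
    ∑ j ∈ Finset.univ.erase (0 : Fin p),
        inner ℝ (InnerProductSpace.gramSchmidtNormed ℝ f j) z ^ 2 =
      ∑ j ∈ Finset.univ.erase (0 : Fin p), inner ℝ (b j) z ^ 2 := by
  have hon := InnerProductSpace.gramSchmidtNormed_orthonormal hf
  have : FiniteDimensional ℝ E := b.toBasis.finiteDimensional_of_finite
  have hfr : Fintype.card (Fin p) = Module.finrank ℝ E := by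
    rw [Module.finrank_eq_card_basis b.toBasis]
  let c : OrthonormalBasis (Fin p) ℝ E := OrthonormalBasis.mk hon (by
    rw [InnerProductSpace.span_gramSchmidtNormed_range, InnerProductSpace.span_gramSchmidt]
    exact (hf.span_eq_top_of_card_eq_finrank hfr).ge)
  have hc : ∀ j, c j = InnerProductSpace.gramSchmidtNormed ℝ f j := by
    intro j
    simp [c]
  have hc0 : c 0 = b 0 := by
    have hg : InnerProductSpace.gramSchmidt ℝ f 0 = f 0 := by
      rw [InnerProductSpace.gramSchmidt_def]
      have : Finset.Iio (0 : Fin p) = ∅ := by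
        ext i
        simp
      simp [this]
    rw [hc, InnerProductSpace.gramSchmidtNormed, hg, h0]
    simp [b.norm_eq_one]
  have h1 := c.sum_sq_inner_right z
  have h2 := b.sum_sq_inner_right z
  rw [← Finset.add_sum_erase _ _ (Finset.mem_univ 0)] at h1 h2
  simp only [← hc]
  rw [hc0] at h1
  linarith

end LinearAlgebra

/-! ### Measurability of the statistic -/

section Measurability

variable {E Ω : Type*} [NormedAddCommGroup E] [InnerProductSpace ℝ E] [MeasurableSpace E]
  [BorelSpace E] [SecondCountableTopology E] [MeasurableSpace Ω]

lemma measurable_gramSchmidt {p : ℕ} {f : Ω → Fin p → E} (hf : ∀ j, Measurable fun ω => f ω j)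
    (j : Fin p) : Measurable fun ω => InnerProductSpace.gramSchmidt ℝ (f ω) j := by
  induction j using WellFoundedLT.induction with
  | _ j ih =>
    have h : ∀ ω, InnerProductSpace.gramSchmidt ℝ (f ω) j = f ω j -
        ∑ i ∈ Finset.Iio j, (inner ℝ (InnerProductSpace.gramSchmidt ℝ (f ω) i) (f ω j) /
          ‖InnerProductSpace.gramSchmidt ℝ (f ω) i‖ ^ 2) •
          InnerProductSpace.gramSchmidt ℝ (f ω) i := by
      intro ω
      rw [InnerProductSpace.gramSchmidt_def]
      simp [Submodule.starProjection_singleton]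
    simp only [h]
    refine (hf j).sub (Finset.measurable_sum _ fun i hi => ?_)
    have := ih i (Finset.mem_Iio.1 hi)
    exact ((this.inner (hf j)).div (this.norm.pow_const 2)).smul this

lemma measurable_gramSchmidtNormed {p : ℕ} {f : Ω → Fin p → E}
    (hf : ∀ j, Measurable fun ω => f ω j) (j : Fin p) :
    Measurable fun ω => InnerProductSpace.gramSchmidtNormed ℝ (f ω) j := by
  have h := measurable_gramSchmidt hf j
  exact h.norm.inv.smul h

end Measurability

lemma dotProduct_eq_inner {p : ℕ} (x y : EuclideanSpace ℝ (Fin p)) :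
    x.ofLp ⬝ᵥ y.ofLp = inner ℝ x y := by
  simp [PiLp.inner_apply, dotProduct, mul_comm]

lemma measurable_sampleCov_apply {p n : ℕ} (j k : Fin p) :
    Measurable fun x : Fin n → EuclideanSpace ℝ (Fin p) => sampleCov x j k := by
  have : ∀ x : Fin n → EuclideanSpace ℝ (Fin p), sampleCov x j k =
      (n : ℝ)⁻¹ * ∑ i, (x i j - (n : ℝ)⁻¹ * ∑ l, x l j) * (x i k - (n : ℝ)⁻¹ * ∑ l, x l k) := by
    intro x
    simp [sampleCov, Matrix.sum_apply, Matrix.vecMulVec_apply, sampleMean]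
  simp only [this]
  fun_prop

lemma measurable_dotProduct_sampleCov {p n : ℕ}
    {f g : (Fin n → EuclideanSpace ℝ (Fin p)) → EuclideanSpace ℝ (Fin p)}
    (hf : Measurable f) (hg : Measurable g) :
    Measurable fun x => (f x).ofLp ⬝ᵥ Matrix.mulVec (sampleCov x) (g x).ofLp := by
  simp only [dotProduct, Matrix.mulVec]
  have := measurable_sampleCov_apply (p := p) (n := n)
  fun_prop

/-- As Rayleigh quotients, the eigenvalues inherit measurability from the chosen eigenvectors. -/
lemma IsSampleEigenvectors.sampleEigenvalue_eq {p n : ℕ}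
    {θhat : (Fin n → EuclideanSpace ℝ (Fin p)) → Fin p → EuclideanSpace ℝ (Fin p)}
    (h : IsSampleEigenvectors θhat) (x : Fin n → EuclideanSpace ℝ (Fin p)) (j : Fin p) :
    sampleEigenvalue x j =
      (θhat x j).ofLp ⬝ᵥ Matrix.mulVec (sampleCov x) (θhat x j).ofLp := by
  rw [h.mulVec_eq, dotProduct_smul, dotProduct_eq_inner, real_inner_self_eq_norm_sq,
    h.norm_eq_one]
  simp

lemma IsSampleEigenvectors.measurable_sampleEigenvalue {p n : ℕ}
    {θhat : (Fin n → EuclideanSpace ℝ (Fin p)) → Fin p → EuclideanSpace ℝ (Fin p)}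
    (h : IsSampleEigenvectors θhat) (j : Fin p) :
    Measurable fun x : Fin n → EuclideanSpace ℝ (Fin p) => sampleEigenvalue x j := by
  simp only [h.sampleEigenvalue_eq]
  exact measurable_dotProduct_sampleCov (h.measurable j) (h.measurable j)

lemma IsSampleEigenvectors.measurable_hpvStatistic {p n : ℕ} [NeZero p]
    {θhat : (Fin n → EuclideanSpace ℝ (Fin p)) → Fin p → EuclideanSpace ℝ (Fin p)}
    (h : IsSampleEigenvectors θhat) (θ₀ : EuclideanSpace ℝ (Fin p)) :
    Measurable (hpvStatistic θ₀ θhat) := by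
  unfold hpvStatistic
  refine (measurable_const.div (h.measurable_sampleEigenvalue 0)).mul
    (Finset.measurable_sum _ fun j _ => ?_)
  refine (h.measurable_sampleEigenvalue j).inv.mul
    ((measurable_dotProduct_sampleCov ?_ measurable_const).pow_const 2)
  refine measurable_gramSchmidtNormed (fun i => ?_) j
  rcases eq_or_ne i 0 with rfl | hi
  · simp
  · simp only [Function.update_of_ne hi]
    exact h.measurable i

/-! ### The sample covariance operator -/

/-- The sample covariance matrix as a linear map. -/
noncomputable def sampleCovMap {p n : ℕ} (x : Fin n → EuclideanSpace ℝ (Fin p)) :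
    EuclideanSpace ℝ (Fin p) →ₗ[ℝ] EuclideanSpace ℝ (Fin p) :=
  Matrix.toEuclideanLin (sampleCov x)

lemma sampleCovMap_ofLp {p n : ℕ} (x : Fin n → EuclideanSpace ℝ (Fin p))
    (y : EuclideanSpace ℝ (Fin p)) :
    (sampleCovMap x y).ofLp = Matrix.mulVec (sampleCov x) y.ofLp := rfl

lemma sampleCovMap_isSymmetric {p n : ℕ} (x : Fin n → EuclideanSpace ℝ (Fin p)) :
    (sampleCovMap x).IsSymmetric :=
  Matrix.isSymmetric_toEuclideanLin_iff.2 (sampleCov_isHermitian x)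

/-- A separate basis is needed because the `θhat x j` are not assumed orthogonal; they could
coincide at a multiple eigenvalue. -/
lemma exists_eigenbasis {p n : ℕ} (x : Fin n → EuclideanSpace ℝ (Fin p)) :
    ∃ e : OrthonormalBasis (Fin p) ℝ (EuclideanSpace ℝ (Fin p)),
      ∀ j, sampleCovMap x (e j) = sampleEigenvalue x j • e j := by
  let h := sampleCov_isHermitian x
  let σ : Fin p ≃ Fin p :=
    (Fintype.equivOfCardEq (Fintype.card_fin _)).symm.trans (finCongr (Fintype.card_fin p))
  refine ⟨h.eigenvectorBasis.reindex σ, fun j => ?_⟩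
  have hj := h.mulVec_eigenvectorBasis (σ.symm j)
  have hl : h.eigenvalues (σ.symm j) = sampleEigenvalue x j := by
    rw [Matrix.IsHermitian.eigenvalues, sampleEigenvalue]
    congr 1
    simp [σ]
  rw [hl] at hj
  rw [OrthonormalBasis.reindex_apply]
  ext i
  exact congrFun hj i

lemma sampleEigenvalue_le_zero_index {p n : ℕ} [NeZero p] (x : Fin n → EuclideanSpace ℝ (Fin p))
    (j : Fin p) : sampleEigenvalue x j ≤ sampleEigenvalue x 0 :=
  (sampleCov_isHermitian x).eigenvalues₀_antitone (by simp)

/-- The statistic when no eigenvector of the sample covariance matrix is orthogonal to the spike: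
the sum of the squares is that of the coordinates in any orthonormal basis. -/
lemma sum_sq_gramSchmidtFrom {p n : ℕ} [NeZero p]
    {θhat : (Fin n → EuclideanSpace ℝ (Fin p)) → Fin p → EuclideanSpace ℝ (Fin p)}
    (h : IsSampleEigenvectors θhat) (b : OrthonormalBasis (Fin p) ℝ (EuclideanSpace ℝ (Fin p)))
    (x : Fin n → EuclideanSpace ℝ (Fin p))
    (hx : ∀ (y : EuclideanSpace ℝ (Fin p)) (l : ℝ), sampleCovMap x y = l • y →
      inner ℝ (b 0) y = 0 → y = 0) :
    ∑ j ∈ Finset.univ.erase (0 : Fin p), ((gramSchmidtFrom (b 0) (θhat x) j).ofLp ⬝ᵥ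
        Matrix.mulVec (sampleCov x) (b 0).ofLp) ^ 2 =
      ∑ j ∈ Finset.univ.erase (0 : Fin p),
        ((b j).ofLp ⬝ᵥ Matrix.mulVec (sampleCov x) (b 0).ofLp) ^ 2 := by
  obtain ⟨e, he⟩ := exists_eigenbasis x
  have hli := linearIndependent_update (sampleCovMap_isSymmetric x) hx
    (eigenvalue_injective_of_forall hx e he) (h.norm_eq_one x)
    (fun j => by
      ext i
      exact congrFun (h.mulVec_eq x j) i)
  have hs := sum_sq_inner_gramSchmidtNormed b hli (by simp) (sampleCovMap x (b 0))
  simp only [← dotProduct_eq_inner, sampleCovMap_ofLp] at hs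
  exact hs

/-! ### Slutsky's lemma with a relative error -/

/-- If `X n` converges in distribution and `|Q n - X n| ≤ D n * X n` eventually, with `D n → 0`,
almost surely, then `Q n` has the same limit in distribution. -/
lemma tendstoInDistribution_of_abs_sub_le_mul {Ω Ω' : Type*} [MeasurableSpace Ω]
    [MeasurableSpace Ω'] {P : Measure Ω} [IsProbabilityMeasure P] {P' : Measure Ω'}
    [IsProbabilityMeasure P'] {X Q : ℕ → Ω → ℝ} {Z : Ω' → ℝ}
    (hX : TendstoInDistribution X atTop Z (fun _ => P) P')
    (hXm : ∀ n, Measurable (X n)) (hQm : ∀ n, Measurable (Q n)) (hX0 : ∀ n ω, 0 ≤ X n ω)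
    (h : ∀ᵐ ω ∂P, ∃ D : ℕ → ℝ, Tendsto D atTop (𝓝 0) ∧
      ∀ᶠ n in atTop, |Q n ω - X n ω| ≤ D n * X n ω) :
    TendstoInDistribution Q atTop Z (fun _ => P) P' := by
  classical
  -- The ratio `Q n / X n` tends to one almost surely, so `X n * R n` has the limit of `X n`. Where
  -- `X n` vanishes the bound forces `Q n = 0`, and the value `1` is harmless.
  let R : ℕ → Ω → ℝ := fun n ω => if X n ω = 0 then 1 else Q n ω / X n ω
  have hRm : ∀ n, Measurable (R n) := fun n =>
    Measurable.ite (hXm n (measurableSet_singleton 0)) measurable_const ((hQm n).div (hXm n))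
  have hR : TendstoInMeasure P R atTop (fun _ => (1 : ℝ)) := by
    refine tendstoInMeasure_of_tendsto_ae (fun n => (hRm n).aestronglyMeasurable) ?_
    filter_upwards [h] with ω hω
    obtain ⟨D, hD, hle⟩ := hω
    rw [tendsto_iff_norm_sub_tendsto_zero]
    refine squeeze_zero' (g := fun n => |D n|) (Eventually.of_forall fun n => norm_nonneg _) ?_
      (by simpa using hD.abs)
    filter_upwards [hle] with n hn
    simp only [R, Real.norm_eq_abs]
    split_ifs with h0
    · simp
    · have hpos : 0 < X n ω := (hX0 n ω).lt_of_ne' h0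
      have : Q n ω / X n ω - 1 = (Q n ω - X n ω) / X n ω := by field_simp
      rw [this, abs_div, abs_of_pos hpos, div_le_iff₀ hpos]
      exact hn.trans (mul_le_mul_of_nonneg_right (le_abs_self _) hpos.le)
  have hprod := hX.continuous_comp_prodMk_of_tendstoInMeasure_const
    (g := fun x : ℝ × ℝ => x.1 * x.2) (by fun_prop) hR (fun n => (hRm n).aemeasurable)
  simp only [mul_one] at hprod
  refine tendstoInDistribution_of_tendstoInMeasure_sub Q Z hprod ?_
    (fun n => (hQm n).aemeasurable)
  refine tendstoInMeasure_of_tendsto_ae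
    (fun n => ((hQm n).sub ((hXm n).mul (hRm n))).aestronglyMeasurable) ?_
  filter_upwards [h] with ω hω
  obtain ⟨D, -, hle⟩ := hω
  refine tendsto_const_nhds.congr' ?_
  filter_upwards [hle] with n hn
  simp only [R, Pi.zero_apply, Pi.sub_apply]
  split_ifs with h0
  · rw [h0, mul_zero, sub_zero] at hn
    rw [h0, zero_mul, sub_zero]
    exact (abs_nonpos_iff.1 hn).symm
  · field_simp
    simp

/-! ### The exactly chi-square projection statistic -/

/-- The direction of the centred version of the column `x` (an arbitrary one if it vanishes). -/
noncomputable def centredDirection {n : ℕ} (x : Fin n → ℝ) (i : Fin n) : ℝ :=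
  if ∑ l, (x l - (n : ℝ)⁻¹ * ∑ m, x m) ^ 2 = 0 then (if (i : ℕ) = 0 then 1 else 0)
  else (x i - (n : ℝ)⁻¹ * ∑ m, x m) / √(∑ l, (x l - (n : ℝ)⁻¹ * ∑ m, x m) ^ 2)

lemma measurable_centredDirection {n : ℕ} (i : Fin n) :
    Measurable fun x : Fin n → ℝ => centredDirection x i := by
  have h : Measurable fun x : Fin n → ℝ => ∑ l, (x l - (n : ℝ)⁻¹ * ∑ m, x m) ^ 2 := by fun_prop
  exact Measurable.ite (h (measurableSet_singleton 0)) measurable_const (by fun_prop)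

lemma sum_sq_centredDirection {n : ℕ} (hn : n ≠ 0) (x : Fin n → ℝ) :
    ∑ i, centredDirection x i ^ 2 = 1 := by
  unfold centredDirection
  split_ifs with h
  · rw [Finset.sum_eq_single (⟨0, Nat.pos_of_ne_zero hn⟩ : Fin n)]
    · simp
    · intro i _ hi
      have : (i : ℕ) ≠ 0 := fun h => hi (Fin.ext h)
      simp [this]
    · simp
  · simp only [div_pow]
    rw [← Finset.sum_div, Real.sq_sqrt (Finset.sum_nonneg fun _ _ => sq_nonneg _), div_self h]

/-- The sum of the squares of the projections of the columns `j ≠ 0` of the array on the direction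
of the centred column `0`. -/
noncomputable def projectionStatistic {p : ℕ} [NeZero p] (n : ℕ) (ω : ℕ × Fin p → ℝ) : ℝ :=
  ∑ j ∈ Finset.univ.erase (0 : Fin p),
    (∑ i, centredDirection (column n ω 0) i * column n ω j i) ^ 2

lemma measurable_projectionStatistic {p : ℕ} [NeZero p] (n : ℕ) :
    Measurable (projectionStatistic (p := p) n) := by
  have h : ∀ i, Measurable fun ω : ℕ × Fin p → ℝ => centredDirection (column n ω 0) i :=
    fun i => (measurable_centredDirection i).comp (by unfold column; fun_prop)
  unfold projectionStatistic column at *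
  fun_prop

lemma map_projectionStatistic {p n : ℕ} [NeZero p] (hn : n ≠ 0) :
    (arrayLaw p).map (projectionStatistic n) = chiSquare (p - 1) := by
  have hinj : Function.Injective fun a : Fin p × Fin n => ((a.2 : ℕ), a.1) := by
    rintro ⟨i, j⟩ ⟨i', j'⟩ h
    simp only [Prod.mk.injEq] at h ⊢
    exact ⟨h.2, Fin.ext h.1⟩
  have h := map_sum_sq_projection (0 : Fin p) (centredDirection (n := n))
    measurable_centredDirection (sum_sq_centredDirection hn)
  rw [Fintype.card_fin] at h
  have hm : ∀ i, Measurable fun y : Fin p → Fin n → ℝ => centredDirection (y 0) i :=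
    fun i => (measurable_centredDirection i).comp (by fun_prop)
  rw [← h, ← map_arrayLaw_of_injective₂ hinj, Measure.map_map (by fun_prop) (by fun_prop)]
  rfl

lemma tendstoInDistribution_projectionStatistic (p : ℕ) [NeZero p] :
    TendstoInDistribution (projectionStatistic (p := p)) atTop id (fun _ => arrayLaw p)
      (chiSquare (p - 1)) where
  forall_aemeasurable n := (measurable_projectionStatistic n).aemeasurable
  tendsto := by
    refine tendsto_const_nhds.congr' ?_
    filter_upwards [eventually_ne_atTop 0] with n hn
    refine Subtype.ext ?_
    change (chiSquare (p - 1)).map id = (arrayLaw p).map (projectionStatistic n)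
    rw [map_projectionStatistic hn, Measure.map_id]

lemma spikeScale_sq {p : ℕ} [NeZero p] {t : ℝ} (ht : 0 ≤ t) :
    spikeScale t (0 : Fin p) ^ 2 = 1 + t := by
  rw [spikeScale, if_pos rfl, Real.sq_sqrt (by linarith)]

/-- The squared norm of the component of `S θ₀` orthogonal to `θ₀`. -/
lemma sum_sq_sampleCov_arraySample {p n : ℕ} [NeZero p]
    (b : OrthonormalBasis (Fin p) ℝ (EuclideanSpace ℝ (Fin p))) {t : ℝ} (ht : 0 ≤ t)
    (hn : n ≠ 0) (ω : ℕ × Fin p → ℝ) (h0 : columnCov (column n ω 0) (column n ω 0) ≠ 0) :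
    n * ∑ j ∈ Finset.univ.erase (0 : Fin p), ((b j).ofLp ⬝ᵥ
        Matrix.mulVec (sampleCov (arraySample b t n ω)) (b 0).ofLp) ^ 2 =
      (1 + t) * columnCov (column n ω 0) (column n ω 0) * projectionStatistic n ω := by
  have hn' : (n : ℝ) ≠ 0 := Nat.cast_ne_zero.2 hn
  set s := columnCov (column n ω 0) (column n ω 0) with hs
  have hss : ∑ l, (column n ω 0 l - (n : ℝ)⁻¹ * ∑ m, column n ω 0 m) ^ 2 = n * s := by
    rw [hs, columnCov, mul_inv_cancel_left₀ hn']
    simp only [pow_two]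
  have hs0 : 0 ≤ n * s := by
    rw [← hss]
    exact Finset.sum_nonneg fun _ _ => sq_nonneg _
  rw [projectionStatistic, Finset.mul_sum, Finset.mul_sum]
  refine Finset.sum_congr rfl fun j hj => ?_
  have hu : ∑ i, centredDirection (column n ω 0) i * column n ω j i =
      n * columnCov (column n ω 0) (column n ω j) / √(n * s) := by
    rw [columnCov_eq' hn, Finset.sum_div]
    refine Finset.sum_congr rfl fun i _ => ?_
    rw [centredDirection, hss, if_neg (mul_ne_zero hn' h0)]
    ring
  rw [hu, dotProduct_sampleCov_arraySample, div_pow, Real.sq_sqrt hs0, mul_pow, mul_pow,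
    spikeScale_sq ht, spikeScale, if_neg (Finset.ne_of_mem_erase hj), columnCov_comm]
  field_simp

lemma inner_sampleCovMap_arraySample {p n : ℕ} [NeZero p]
    (b : OrthonormalBasis (Fin p) ℝ (EuclideanSpace ℝ (Fin p))) (t : ℝ) (ω : ℕ × Fin p → ℝ)
    (j k : Fin p) :
    inner ℝ (b j) (sampleCovMap (arraySample b t n ω) (b k)) =
      spikeScale t j * spikeScale t k * columnCov (column n ω j) (column n ω k) := by
  rw [← dotProduct_eq_inner, sampleCovMap_ofLp, dotProduct_sampleCov_arraySample]

lemma forall_eigenvector_of_det_krylov_ne_zero {p n : ℕ} [NeZero p]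
    (b : OrthonormalBasis (Fin p) ℝ (EuclideanSpace ℝ (Fin p))) (t : ℝ) (ω : ℕ × Fin p → ℝ)
    (h : (krylov (scaledCov (spikeScale t)
      fun a : Fin n × Fin p => ω ((a.1 : ℕ), a.2))).det ≠ 0)
    (y : EuclideanSpace ℝ (Fin p)) (l : ℝ)
    (hy : sampleCovMap (arraySample b t n ω) y = l • y) (h0 : inner ℝ (b 0) y = 0) : y = 0 := by
  have hz := eq_zero_of_det_krylov_ne_zero (scaledCov_isSymm _ _) h
    (y := fun j => inner ℝ (b j) y) (l := l) ?_ h0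
  · rw [← b.sum_repr' y]
    exact Finset.sum_eq_zero fun j _ => by rw [congrFun hz j, Pi.zero_apply, zero_smul]
  · ext j
    have h1 : inner ℝ (b j) (sampleCovMap (arraySample b t n ω) y) = l * inner ℝ (b j) y := by
      rw [hy, inner_smul_right]
    rw [Pi.smul_apply, smul_eq_mul, ← h1]
    conv_rhs => rw [← b.sum_repr' y]
    rw [map_sum, inner_sum, Matrix.mulVec, dotProduct]
    refine Finset.sum_congr rfl fun k _ => ?_
    rw [map_smul, inner_smul_right, inner_sampleCovMap_arraySample, mul_comm]
    rfl

/-! ### Comparison with the projection statistic -/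

/-- Here `χ` is a sum of nonnegative terms `N * q j ^ 2 / G`, and the weights multiply term `j` by
`G / (l₀ * l j)`. The error is therefore relative to `χ`. -/
lemma abs_sum_sub_le {ι : Type*} (s : Finset ι) {N G χ l₀ : ℝ} (l q : ι → ℝ) (hN : 0 ≤ N)
    (hG : 0 < G) (hq : N * ∑ j ∈ s, q j ^ 2 = G * χ) :
    |N / l₀ * ∑ j ∈ s, (l j)⁻¹ * q j ^ 2 - χ| ≤ (∑ j ∈ s, |G / (l₀ * l j) - 1|) * χ := by
  have hχ : χ = ∑ j ∈ s, N * q j ^ 2 / G := by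
    rw [← Finset.sum_div, ← Finset.mul_sum, hq]
    field_simp
  have ht : ∀ j, 0 ≤ N * q j ^ 2 / G := fun j => by positivity
  have hsub : N / l₀ * ∑ j ∈ s, (l j)⁻¹ * q j ^ 2 - χ =
      ∑ j ∈ s, (G / (l₀ * l j) - 1) * (N * q j ^ 2 / G) := by
    simp only [sub_mul, one_mul, Finset.sum_sub_distrib]
    rw [← hχ, Finset.mul_sum]
    congr 1
    refine Finset.sum_congr rfl fun j _ => ?_
    have : G ≠ 0 := hG.ne'
    rw [div_mul_div_comm, mul_comm (l₀ * l j) G, mul_div_mul_left _ _ this]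
    simp only [div_eq_mul_inv, mul_inv]
    ring
  rw [hsub, Finset.sum_mul]
  refine (Finset.abs_sum_le_sum_abs _ _).trans (Finset.sum_le_sum fun j hj => ?_)
  rw [abs_mul, abs_of_nonneg (ht j)]
  refine mul_le_mul_of_nonneg_left ?_ (abs_nonneg _)
  rw [hχ]
  exact Finset.single_le_sum (f := fun j => N * q j ^ 2 / G) (fun j _ => ht j) hj

/-- The sample eigenvalues are asymptotically those of the population covariance matrix. -/
lemma tendsto_sampleEigenvalue_sub {p : ℕ} [NeZero p]
    (b : OrthonormalBasis (Fin p) ℝ (EuclideanSpace ℝ (Fin p))) {t : ℕ → ℝ} {B : ℝ}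
    (ht : ∀ n, 0 ≤ t n) (htB : ∀ n, t n ≤ B) {ω : ℕ × Fin p → ℝ}
    (hω : ∀ j k : Fin p, Tendsto (fun n : ℕ => columnCov (column n ω j) (column n ω k)) atTop
      (𝓝 (if j = k then 1 else 0))) (j : Fin p) :
    Tendsto (fun n => sampleEigenvalue (arraySample b (t n) n ω) j - spikeScale (t n) j ^ 2)
      atTop (𝓝 0) := by
  let d : ℕ → Fin p → Fin p → ℝ := fun n j k =>
    |columnCov (column n ω j) (column n ω k) - if j = k then 1 else 0|
  -- The factor `1 + B` bounds the product of two scales, each at most `√(1 + B)`. The boundedness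
  -- of `r` enters here.
  let ε : ℕ → ℝ := fun n => (1 + B) * ∑ j, ∑ k, d n j k
  have hd : ∀ j k, Tendsto (fun n => d n j k) atTop (𝓝 0) := fun j k => by
    have := ((hω j k).sub_const (if j = k then 1 else 0)).abs
    simpa using this
  have hε : Tendsto ε atTop (𝓝 0) := by
    have := (tendsto_finsetSum Finset.univ fun j _ =>
      tendsto_finsetSum Finset.univ fun k _ => hd j k).const_mul (1 + B)
    simpa using this
  have hc : ∀ n (j : Fin p), 0 ≤ spikeScale (t n) j ∧ spikeScale (t n) j ≤ √(1 + B) := by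
    intro n j
    have h1 : (1 : ℝ) ≤ √(1 + B) := by
      rw [Real.one_le_sqrt]
      linarith [ht n, htB n]
    unfold spikeScale
    split_ifs
    · exact ⟨Real.sqrt_nonneg _, Real.sqrt_le_sqrt (by linarith [htB n])⟩
    · exact ⟨zero_le_one, h1⟩
  have hB : 0 ≤ 1 + B := by linarith [ht 0, htB 0]
  have hle : ∀ n, |sampleEigenvalue (arraySample b (t n) n ω) j - spikeScale (t n) j ^ 2| ≤
      (p + p ^ 3) * ε n := by
    intro n
    obtain ⟨e, he⟩ := exists_eigenbasis (arraySample b (t n) n ω)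
    refine abs_eigenvalue_sub_le (sampleCovMap_isSymmetric _) e b
      (sampleEigenvalue_le_zero_index _) he (m := fun j => spikeScale (t n) j ^ 2) ?_ ?_ ?_ j
    · rw [spikeScale_sq (ht n)]
      linarith [ht n]
    · intro j hj
      simp [spikeScale, hj]
    · intro j k
      have h1 : inner ℝ (b j) (sampleCovMap (arraySample b (t n) n ω) (b k)) -
          (if j = k then spikeScale (t n) j ^ 2 else 0) = spikeScale (t n) j * spikeScale (t n) k *
            (columnCov (column n ω j) (column n ω k) - if j = k then 1 else 0) := by
        rw [inner_sampleCovMap_arraySample]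
        split_ifs with h
        · subst h; ring
        · ring
      rw [h1, abs_mul]
      refine mul_le_mul ?_ ?_ (abs_nonneg _) hB
      · rw [abs_of_nonneg (mul_nonneg (hc n j).1 (hc n k).1), ← Real.mul_self_sqrt hB]
        exact mul_le_mul (hc n j).2 (hc n k).2 (hc n k).1 (Real.sqrt_nonneg _)
      · exact (Finset.single_le_sum (f := fun k => d n j k) (fun k _ => abs_nonneg _)
          (Finset.mem_univ k)).trans (Finset.single_le_sum (f := fun j => ∑ k, d n j k)
          (fun j _ => Finset.sum_nonneg fun k _ => abs_nonneg _) (Finset.mem_univ j))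
  exact squeeze_zero_norm hle (by simpa using hε.const_mul ((p : ℝ) + p ^ 3))

/-- The statistic differs from the projection statistic by a vanishing relative error. -/
lemma ae_abs_hpvStatistic_sub_le {p : ℕ} [NeZero p]
    (b : OrthonormalBasis (Fin p) ℝ (EuclideanSpace ℝ (Fin p))) {t : ℕ → ℝ} {B : ℝ}
    (ht : ∀ n, 0 ≤ t n) (htB : ∀ n, t n ≤ B)
    {θhat : ∀ n : ℕ, (Fin n → EuclideanSpace ℝ (Fin p)) → Fin p → EuclideanSpace ℝ (Fin p)}
    (hθhat : ∀ n, IsSampleEigenvectors (θhat n)) :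
    ∀ᵐ ω ∂(arrayLaw p), ∃ D : ℕ → ℝ, Tendsto D atTop (𝓝 0) ∧ ∀ᶠ n in atTop,
      |hpvStatistic (b 0) (θhat n) (arraySample b (t n) n ω) - projectionStatistic n ω| ≤
        D n * projectionStatistic n ω := by
  have hcyc : ∀ᵐ ω ∂(arrayLaw p), ∀ n, p < n → (krylov (scaledCov (spikeScale (t n))
      fun a : Fin n × Fin p => ω ((a.1 : ℕ), a.2))).det ≠ 0 := by
    rw [ae_all_iff]
    intro n
    rcases lt_or_ge p n with hn | hn
    · filter_upwards [ae_det_krylov_ne_zero hn (spikeScale (t n)) (fun j => by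
        unfold spikeScale
        split_ifs
        · exact (Real.sqrt_pos.2 (by linarith [ht n])).ne'
        · exact one_ne_zero)] with ω h _ using h
    · exact Eventually.of_forall fun ω h => absurd h (not_lt.2 hn)
  filter_upwards [hcyc, tendsto_columnCov p] with ω hK hω
  let s : ℕ → ℝ := fun n => columnCov (column n ω 0) (column n ω 0)
  let l : ℕ → Fin p → ℝ := fun n j => sampleEigenvalue (arraySample b (t n) n ω) j
  have hs : Tendsto s atTop (𝓝 1) := by simpa using hω 0 0
  have hl := tendsto_sampleEigenvalue_sub b ht htB hω
  have h1 : Tendsto (fun n => (1 + t n) / l n 0) atTop (𝓝 1) := by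
    -- As `1 + t n ≥ 1`, the absolute error on the top eigenvalue also bounds its relative error.
    have h : Tendsto (fun n => l n 0 / (1 + t n)) atTop (𝓝 1) := by
      rw [tendsto_iff_norm_sub_tendsto_zero]
      refine squeeze_zero (fun n => norm_nonneg _) (fun n => ?_) (by simpa using (hl 0).abs)
      have hpos : 0 < 1 + t n := by linarith [ht n]
      rw [spikeScale_sq (ht n), Real.norm_eq_abs]
      have : l n 0 / (1 + t n) - 1 = (l n 0 - (1 + t n)) / (1 + t n) := by field_simp
      rw [this, abs_div, abs_of_pos hpos]
      exact div_le_self (abs_nonneg _) (by linarith [ht n])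
    simpa using h.inv₀ one_ne_zero
  refine ⟨fun n => ∑ j ∈ Finset.univ.erase (0 : Fin p),
    |(1 + t n) * s n / (l n 0 * l n j) - 1|, ?_, ?_⟩
  · have hzero : ∑ _j ∈ Finset.univ.erase (0 : Fin p), (0 : ℝ) = 0 := Finset.sum_const_zero
    rw [← hzero]
    refine tendsto_finsetSum _ fun j hj => ?_
    have h2 : Tendsto (fun n => l n j) atTop (𝓝 1) := by
      have := (hl j).add_const 1
      simpa [spikeScale, Finset.ne_of_mem_erase hj] using this
    have h3 := ((h1.mul (hs.div h2 one_ne_zero)).sub_const 1).abs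
    simpa [div_mul_div_comm] using h3
  · filter_upwards [eventually_gt_atTop p, hs.eventually_const_lt zero_lt_one] with n hn hsn
    refine abs_sum_sub_le _ _ _ (Nat.cast_nonneg n)
      (mul_pos (by linarith [ht n]) hsn) ?_
    rw [sum_sq_gramSchmidtFrom (hθhat n) b _
      (forall_eigenvector_of_det_krylov_ne_zero b (t n) ω (hK n hn))]
    exact sum_sq_sampleCov_arraySample b (ht n) (by omega) ω hsn.ne'

lemma tendstoInDistribution_hpvStatistic {p : ℕ} [NeZero p]
    (θ₀ : EuclideanSpace ℝ (Fin p)) (hθ₀ : ‖θ₀‖ = 1) {v : ℝ} (hv : 0 < v) {r : ℕ → ℝ}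
    (hr_pos : ∀ n, 0 < r n) (hr_bdd : BddAbove (Set.range r))
    {θhat : ∀ n : ℕ, (Fin n → EuclideanSpace ℝ (Fin p)) → Fin p → EuclideanSpace ℝ (Fin p)}
    (hθhat : ∀ n, IsSampleEigenvectors (θhat n)) :
    TendstoInDistribution (fun n => hpvStatistic θ₀ (θhat n)) atTop id
      (fun n => spikedLaw n 0 1 θ₀ (r n) v) (chiSquare (p - 1)) := by
  have hon : Orthonormal ℝ (({0} : Set (Fin p)).domRestrict fun _ => θ₀) := by
    refine ⟨fun _ => hθ₀, fun i j hij => absurd (Subsingleton.elim i j) hij⟩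
  obtain ⟨b, hb⟩ := hon.exists_orthonormalBasis_extension_of_card_eq (by simp)
  obtain rfl : b 0 = θ₀ := hb 0 rfl
  obtain ⟨B, hB⟩ := hr_bdd
  have ht : ∀ n, 0 ≤ r n * v := fun n => (mul_pos (hr_pos n) hv).le
  have htB : ∀ n, r n * v ≤ B * v := fun n =>
    mul_le_mul_of_nonneg_right (hB ⟨n, rfl⟩) hv.le
  have hQ := fun n => (hθhat n).measurable_hpvStatistic (b 0)
  have hx := fun n => measurable_arraySample b (r n * v) n
  have h := tendstoInDistribution_of_abs_sub_le_mul
    (Q := fun n ω => hpvStatistic (b 0) (θhat n) (arraySample b (r n * v) n ω))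
    (tendstoInDistribution_projectionStatistic p) measurable_projectionStatistic
    (fun n => (hQ n).comp (hx n)) (fun n ω => Finset.sum_nonneg fun _ _ => sq_nonneg _)
    (ae_abs_hpvStatistic_sub_le b ht htB hθhat)
  -- Convergence in distribution depends only on the law for each `n`, so it passes from the coupled
  -- samples to the original ones.
  refine ⟨fun n => (hQ n).aemeasurable, by fun_prop, h.tendsto.congr fun n => Subtype.ext ?_⟩
  change (arrayLaw p).map (hpvStatistic (b 0) (θhat n) ∘ arraySample b (r n * v) n) =
    (spikedLaw n 0 1 (b 0) (r n) v).map (hpvStatistic (b 0) (θhat n))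
  rw [← Measure.map_map (hQ n) (hx n), map_arraySample b (r n) v (ht n)]

end SpikedPCA

theorem theorem3p1 {p : ℕ} [NeZero p] (hp : 2 ≤ p)
    (θ₀ : EuclideanSpace ℝ (Fin p)) (hθ₀ : ‖θ₀‖ = 1)
    (v : ℝ) (hv : 0 < v)
    (r : ℕ → ℝ) (hr_pos : ∀ n, 0 < r n) (hr_bdd : BddAbove (Set.range r))
    (θhat : ∀ n : ℕ, (Fin n → EuclideanSpace ℝ (Fin p)) → Fin p → EuclideanSpace ℝ (Fin p))
    (hθhat : ∀ n, SpikedPCA.IsSampleEigenvectors (θhat n)) :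
    TendstoInDistribution
        (fun n => SpikedPCA.hpvStatistic θ₀ (θhat n)) atTop
        id (fun n => SpikedPCA.spikedLaw n 0 1 θ₀ (r n) v) (SpikedPCA.chiSquare (p - 1)) ∧
      ∀ α : ℝ, 0 < α → α < 1 →
        Tendsto
          (fun n => ∫ x, SpikedPCA.hpvTest α θ₀ (θhat n) x
            ∂(SpikedPCA.spikedLaw n 0 1 θ₀ (r n) v))
          atTop (𝓝 α) := by
  have h := SpikedPCA.tendstoInDistribution_hpvStatistic θ₀ hθ₀ hv hr_pos hr_bdd hθhat
  refine ⟨h, fun α h0 h1 => ?_⟩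
  -- From `2 ≤ p` there is at least one degree of freedom; with none, the limit would be a point
  -- mass at zero.
  refine (SpikedPCA.tendsto_measureReal_gt_quantile (by omega) h h0 h1).congr fun n => ?_
  rw [SpikedPCA.hpvTest, integral_indicator_one]
  exact measurableSet_lt measurable_const ((hθhat n).measurable_hpvStatistic θ₀)
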